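/- Let $d\ge 1$ be an integer. For $g:\mathbb{R}^d\to\mathbb{R}$ let $\hat g$ be its Fourier transform in the sense of tempered distributions, normalized as $\hat g(\xi)=(2\pi)^{-d}\int_{\mathbb{R}^d} g(x)e^{-ix^\top\xi}\,dx$. For $s\in\mathbb{R}$ let $$\|g\|_{\mathcal{B}^s(\mathbb{R}^d)}=\int_{\mathbb{R}^d}|\hat g(\xi)|\,(1+|\xi|^2)^{s/2}\,d\xi$$ if $\hat g$ is a function, and $\|g\|_{\mathcal{B}^s(\mathbb{R}^d)}=\infty$ otherwise. The spectral Barron space $\mathcal{B}^s(\mathbb{R}^d)$ consists of the functions $g$ (identified when equal almost everywhere) with $\|g\|_{\mathcal{B}^s(\mathbb{R}^d)}<\infty$. **Theorem.** Let $s\ge 0$, and let $V:\mathbb{R}^d\to\mathbb{R}$ satisfy $V(x)\ge 0$ for all $x\in\mathbb{R}^d$ and $V=\alpha+W$ with a constant $\alpha>0$ and $W\in\mathcal{B}^s(\mathbb{R}^d)$. Then: 1. For every $f\in\mathcal{B}^s(\mathbb{R}^d)$ the equation $-\Delta u+Vu=f$ in $\mathbb{R}^d$ (understood as an identity of tempered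 distributions) has a unique solution $u^*\in\mathcal{B}^{s+2}(\mathbb{R}^d)$. 2. There is a constant $C\ge 0$, depending only on $V$, $d$ and $s$, such that $\|u^*\|_{\mathcal{B}^{s+2}(\mathbb{R}^d)}\le C\|f\|_{\mathcal{B}^s(\mathbb{R}^d)}$ for all $f\in\mathcal{B}^s(\mathbb{R}^d)$. 3. Let $C$ be any constant as in 2. For every $f\in\mathcal{B}^s(\mathbb{R}^d)$, every bounded open set $\Omega\subset\mathbb{R}^d$ (in particular every bounded domain) and every integer $n\ge 1$ there are $a_j,b_j\in\mathbb{R}$ and $w_j\in\mathbb{R}^d$, $1\le j\le n$, such that the cosine-activated two-layer network $$u_n(x)=\frac1n\sum_{j=1}^n a_j\cos(w_j^\top x+b_j)$$ satisfies $$\|u_n-u^*\|_{H^1(\Omega)}\le\frac{C\sqrt{m(\Omega)}\,\|f\|_{\mathcal{B}^s(\mathbb{R}^d)}}{\sqrt n},$$ where $m(\Omega)$ is the Lebesgue measure of $\Omega$ and $\|g\|_{H^1(\Omega)}^2=\int_\Omega|g|^2\,dx+\sum_{k=1}^d\int_\Omega|\partial_k g|^2\,dx$ with weak derivatives. -/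

import Mathlib

open MeasureTheory
open scoped ENNReal NNReal SchwartzMap FourierTransform Laplacian ContDiff

noncomputable section

/-- `d`-dimensional Euclidean space with its Euclidean norm and Lebesgue measure. -/
abbrev Rd (d : ℕ) : Type := EuclideanSpace ℝ (Fin d)

variable {d : ℕ}

/-- The tempered distribution `T` is the one given by the function `g`, that is
`T φ = ∫ φ(x) g(x) dx`, where the integral converges absolutely for every Schwartz function `φ`. -/
def Represents (T : 𝓢'(Rd d, ℂ)) (g : Rd d → ℂ) : Prop :=
  AEStronglyMeasurable g volume ∧
    ∀ φ : 𝓢(Rd d, ℂ), Integrable (fun x => φ x * g x) volume ∧ T φ = ∫ x, φ x * g x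

/-- The Fourier transform of `g`, taken in the sense of tempered distributions and normalized as
`ĝ(ξ) = (2π)^{-d} ∫ g(x) exp(-i x·ξ) dx`, is the function `h`.
Mathlib's `𝓕` is normalized as `ν ↦ ∫ g(x) exp(-2πi x·ν) dx`, which is `(2π)^d ĝ(2πν)`. -/
def IsFourierTransform (g : Rd d → ℝ) (h : Rd d → ℂ) : Prop :=
  ∃ T : 𝓢'(Rd d, ℂ), Represents T (fun x => (g x : ℂ)) ∧
    Represents (𝓕 T) (fun ν => ((2 * Real.pi) ^ d : ℝ) * h ((2 * Real.pi) • ν))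

/-- The spectral Barron norm `∫ |ĝ(ξ)| (1 + |ξ|²)^{s/2} dξ`. The Fourier transform is unique
up to equality almost everywhere, so that the infimum has at most one value to run over;
it is `∞` when the Fourier transform of `g` is not a function. -/
def barronNorm (s : ℝ) (g : Rd d → ℝ) : ℝ≥0∞ :=
  ⨅ (h : Rd d → ℂ) (_ : IsFourierTransform g h),
    ∫⁻ ξ, ‖h ξ‖ₑ * ENNReal.ofReal ((1 + ‖ξ‖ ^ 2) ^ (s / 2))

/-- The spectral Barron space `𝓑ˢ(ℝᵈ)`; its elements are real functions, to be identified when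
they are equal almost everywhere. -/
def BarronSpace (d : ℕ) (s : ℝ) : Set (Rd d → ℝ) := {g | barronNorm s g < ⊤}

/-- `u` solves `-Δu + V u = f` in `ℝᵈ`, as an identity of tempered distributions. -/
def SolvesSchrodinger (V f u : Rd d → ℝ) : Prop :=
  ∃ U P F : 𝓢'(Rd d, ℂ), Represents U (fun x => (u x : ℂ)) ∧
    Represents P (fun x => ((V x * u x : ℝ) : ℂ)) ∧ Represents F (fun x => (f x : ℂ)) ∧
    -(Δ U) + P = F

/-- The regularity estimate `‖u‖_{𝓑^{s+2}} ≤ C ‖f‖_{𝓑^s}` with the constant `C`, for all `f` in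
`𝓑ˢ` and the solutions `u` in `𝓑^{s+2}` of `-Δu + V u = f`. -/
def RegularityEstimate (V : Rd d → ℝ) (s : ℝ) (C : ℝ≥0) : Prop :=
  ∀ f ∈ BarronSpace d s, ∀ u ∈ BarronSpace d (s + 2), SolvesSchrodinger V f u →
    barronNorm (s + 2) u ≤ C * barronNorm s f

/-- On the open set `Ω`, the function `h` is the weak partial derivative of `g` in the direction
of the `k`-th coordinate. -/
def HasWeakPartialDeriv (Ω : Set (Rd d)) (k : Fin d) (g h : Rd d → ℝ) : Prop :=
  LocallyIntegrableOn g Ω volume ∧ LocallyIntegrableOn h Ω volume ∧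
    ∀ φ : Rd d → ℝ, ContDiff ℝ ∞ φ → HasCompactSupport φ → tsupport φ ⊆ Ω →
      ∫ x in Ω, g x * fderiv ℝ φ x (EuclideanSpace.single k 1) = -∫ x in Ω, h x * φ x

/-- The norm of `H¹(Ω)`, namely `(∫_Ω |g|² + ∑ₖ ∫_Ω |∂ₖ g|²)^{1/2}` with weak derivatives. These
are unique up to equality almost everywhere in `Ω`, so that the infimum has at most one value to
run over; it is `∞` when `g` is not weakly differentiable in `Ω`. -/
def h1Norm (Ω : Set (Rd d)) (g : Rd d → ℝ) : ℝ≥0∞ :=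
  ⨅ (G : Fin d → Rd d → ℝ) (_ : ∀ k, HasWeakPartialDeriv Ω k g (G k)),
    ((∫⁻ x in Ω, ‖g x‖ₑ ^ 2) + ∑ k, ∫⁻ x in Ω, ‖G k x‖ₑ ^ 2) ^ (1 / 2 : ℝ)

/-- The cosine-activated two-layer network `x ↦ (1/n) ∑ⱼ aⱼ cos(wⱼ·x + bⱼ)`. -/
def cosNetwork {n : ℕ} (a : Fin n → ℝ) (w : Fin n → Rd d) (b : Fin n → ℝ) (x : Rd d) : ℝ :=
  (1 / (n : ℝ)) * ∑ j, a j * Real.cos (inner ℝ (w j) x + b j)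

end

/-! Everything happens on the frequency side. With the weight `w = barronWeight s`, a function lies
in the Barron space exactly when it equals `𝓕⁻ H` almost everywhere with `w H` in L¹
(`IsBarronSpectrum`). For `k = w û` and `l = w f̂` the equation becomes `k + m A k = m l` in L¹,
where `m(ν) = 1 / (|2πν|² + α)` and `A` is convolution with the transform of `W`, conjugated by `w`;
Peetre's inequality makes `A` bounded (`solvesSchrodinger_iff`).

Solvability is a Fredholm alternative. The operator `m A` has the form `k ↦ ∫ k(η) Φ(η) dη` with `Φ`
continuous, L¹-valued and vanishing at infinity because `m` does. Such a `Φ` is uniformly close to a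
simple function, so `m A` is a norm limit of finite rank operators, and injectivity of `1 + m A`
gives surjectivity (`surjective_one_add_mulOp_comp_twistedConvolution`).

Injectivity is a maximum principle. For `k` in the kernel, `v = 𝓕⁻ (k / w)` is continuous, tends to
zero by Riemann–Lebesgue and satisfies `Δ v = V v`, with `Δ` read as a limit of second differences.
As `V ≥ 0`, the real and imaginary parts of `v` have neither a positive maximum nor a negative
minimum (`eq_zero_of_tendsto_secondDiff`). Applied to the imaginary part alone, the same argument
shows that the solution for real `f` is real.

For the estimate, the equation gives `(1 + |2πν|²) k = (1 + |2πν|²) m (l - A k)`, whose multiplier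
is bounded, and `k` depends boundedly on `l` by the bounded inverse theorem.

For the approximation, `u` is a mean of cosines over the probability density proportional to `(1 +
|2πν|²)^{(s+2)/2} |û|`, of total mass `B = ‖u‖`. Two extra powers of the weight bound the value and
gradient of each cosine together by `B`, pointwise. Maurey's argument (`exists_sample_sum_sq_le`)
then yields squared H¹ error at most `B² m(Ω) / n`, and `B ≤ C ‖f‖`. -/

open Filter Topology

/-! ### Tempered distributions represented by functions -/

namespace Represents

variable {d : ℕ} {T S : 𝓢'(Rd d, ℂ)} {g h : Rd d → ℂ}

theorem congr_ae (hT : Represents T g) (hgh : g =ᵐ[volume] h) : Represents T h := by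
  have key (φ : 𝓢(Rd d, ℂ)) : (fun x => φ x * g x) =ᵐ[volume] fun x => φ x * h x := by
    filter_upwards [hgh] with x hx
    rw [hx]
  exact ⟨hT.1.congr hgh, fun φ => ⟨(hT.2 φ).1.congr (key φ),
    (hT.2 φ).2.trans (integral_congr_ae (key φ))⟩⟩

theorem eq_of_ae_eq (hT : Represents T g) (hS : Represents S h) (hgh : g =ᵐ[volume] h) :
    T = S := by
  ext φ
  rw [((hT.congr_ae hgh).2 φ).2, (hS.2 φ).2]

theorem add (hT : Represents T g) (hS : Represents S h) :
    Represents (T + S) (fun x => g x + h x) := by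
  refine ⟨hT.1.add hS.1, fun φ => ?_⟩
  simp only [mul_add]
  refine ⟨(hT.2 φ).1.add (hS.2 φ).1, ?_⟩
  rw [integral_add (hT.2 φ).1 (hS.2 φ).1, ← (hT.2 φ).2, ← (hS.2 φ).2]
  rfl

theorem neg (hT : Represents T g) : Represents (-T) (fun x => -g x) := by
  refine ⟨hT.1.neg, fun φ => ?_⟩
  simp only [mul_neg]
  refine ⟨(hT.2 φ).1.neg, ?_⟩
  rw [integral_neg, ← (hT.2 φ).2]
  rfl

theorem const_smul (hT : Represents T g) (c : ℂ) : Represents (c • T) (fun x => c * g x) := by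
  refine ⟨hT.1.const_mul c, fun φ => ?_⟩
  simp only [mul_left_comm _ c]
  refine ⟨(hT.2 φ).1.const_mul c, ?_⟩
  rw [integral_const_mul, ← (hT.2 φ).2]
  rfl

theorem locallyIntegrable (hT : Represents T g) : LocallyIntegrable g volume := by
  intro x
  obtain ⟨f, hf, hf1⟩ : ∃ f : ContDiffBump x, f.rIn = 1 ∧ f.rOut = 2 :=
    ⟨⟨1, 2, by norm_num, by norm_num⟩, rfl, rfl⟩
  have hg₁ : HasCompactSupport (Complex.ofRealCLM ∘ f) := f.hasCompactSupport.comp_left rfl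
  have hg₂ : ContDiff ℝ ∞ (Complex.ofRealCLM ∘ f) :=
    Complex.ofRealCLM.contDiff.comp f.contDiff
  refine ⟨Metric.closedBall x f.rIn, Metric.closedBall_mem_nhds x f.rIn_pos, ?_⟩
  have := (hT.2 (hg₁.toSchwartzMap hg₂)).1.integrableOn (s := Metric.closedBall x f.rIn)
  refine this.congr_fun (fun y hy => ?_) measurableSet_closedBall
  simp [f.one_of_mem_closedBall hy]

/-- The fundamental lemma of the calculus of variations, since compactly supported smooth functions
are Schwartz. This makes the Fourier transform of a function unique almost everywhere. -/
theorem ae_eq (hT : Represents T g) (hT' : Represents T h) : g =ᵐ[volume] h := by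
  refine ae_eq_of_integral_contDiff_smul_eq hT.locallyIntegrable hT'.locallyIntegrable
    fun φ hφ hc => ?_
  have hg₁ : HasCompactSupport (Complex.ofRealCLM ∘ φ) := hc.comp_left rfl
  have hg₂ : ContDiff ℝ ∞ (Complex.ofRealCLM ∘ φ) := Complex.ofRealCLM.contDiff.comp hφ
  have h1 := (hT.2 (hg₁.toSchwartzMap hg₂)).2
  rw [(hT'.2 (hg₁.toSchwartzMap hg₂)).2] at h1
  simpa using h1.symm

end Represents

theorem MeasureTheory.MemLp.exists_represents {d : ℕ} {g : Rd d → ℂ} {p : ℝ≥0∞} [hp : Fact (1 ≤ p)]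
    (hg : MemLp g p volume) : ∃ T : 𝓢'(Rd d, ℂ), Represents T g := by
  have h : Represents (Lp.toTemperedDistribution (hg.toLp g)) (hg.toLp g) := by
    refine ⟨Lp.aestronglyMeasurable _, fun φ => ⟨?_, ?_⟩⟩
    · have := ENNReal.HolderConjugate.inv_one_sub_inv' hp.out
      exact MemLp.integrable_mul (p := (1 - p⁻¹)⁻¹) (q := p) (φ.memLp _ _) (Lp.memLp _)
    · simp
  exact ⟨_, h.congr_ae hg.coeFn_toLp⟩

/-! ### Fourier inversion for integrable spectra, in the sense of distributions. -/

section Fourier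

variable {d : ℕ} {T : 𝓢'(Rd d, ℂ)} {g H : Rd d → ℂ}

/-- Fubini. The self-adjointness of the forward transform is applied to the reflection of `H`, and a
change of sign of the variable turns both transforms into inverse ones. -/
theorem integral_fourierInv_mul_eq_of_integrable (φ : 𝓢(Rd d, ℂ)) (hH : Integrable H) :
    ∫ x, (𝓕⁻ φ) x * H x = ∫ x, φ x * (𝓕⁻ H) x := by
  have h := VectorFourier.integral_fourierIntegral_smul_eq_flip (L := innerₗ (Rd d))
    (μ := volume) (ν := volume) (f := φ) (g := fun x => H (-x))
    Real.continuous_fourierChar continuous_inner φ.integrable hH.comp_neg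
  simp only [flip_innerₗ, smul_eq_mul] at h
  rw [← integral_neg_eq_self] at h
  simp only [neg_neg] at h
  calc _ = _ := ?_
    _ = _ := h
    _ = _ := ?_
  · refine integral_congr_ae (.of_forall fun x => ?_)
    simp only [SchwartzMap.fourierInv_coe, Real.fourierInv_eq_fourier_neg]
    rfl
  · refine integral_congr_ae (.of_forall fun x => ?_)
    simp only [Real.fourierInv_eq_fourier_comp_neg]
    rfl

theorem continuous_fourierInv_of_integrable (hH : Integrable H) : Continuous (𝓕⁻ H) := by
  have : 𝓕⁻ H = fun x => 𝓕 H (-x) := by ext x; rw [Real.fourierInv_eq_fourier_neg]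
  rw [this]
  exact (VectorFourier.fourierIntegral_continuous (L := innerₗ (Rd d)) Real.continuous_fourierChar
    continuous_inner hH).comp continuous_neg

theorem norm_fourierInv_le (H : Rd d → ℂ) (x : Rd d) : ‖(𝓕⁻ H) x‖ ≤ ∫ ν, ‖H ν‖ := by
  rw [Real.fourierInv_eq_fourier_neg]
  exact VectorFourier.norm_fourierIntegral_le_integral_norm _ _ _ _ _

theorem memLp_top_fourierInv (hH : Integrable H) : MemLp (𝓕⁻ H) ∞ volume :=
  memLp_top_of_bound (continuous_fourierInv_of_integrable hH).aestronglyMeasurable _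
    (.of_forall (norm_fourierInv_le H))

theorem Represents.fourierInv (hT : Represents T H) (hH : Integrable H) :
    Represents (𝓕⁻ T) (𝓕⁻ H) := by
  obtain ⟨S, hS⟩ := (memLp_top_fourierInv hH).exists_represents
  convert hS
  ext φ
  rw [TemperedDistribution.fourierInv_apply, (hT.2 _).2, (hS.2 φ).2,
    integral_fourierInv_mul_eq_of_integrable φ hH]

theorem Represents.ae_eq_fourierInv (hT : Represents T g) (hF : Represents (𝓕 T) H)
    (hH : Integrable H) : g =ᵐ[volume] 𝓕⁻ H := by
  have := hF.fourierInv hH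
  rw [FourierTransform.fourierInv_fourier_eq] at this
  exact hT.ae_eq this

theorem Represents.fourier_of_ae_eq (hT : Represents T g) (hH : Integrable H)
    (hg : g =ᵐ[volume] 𝓕⁻ H) : Represents (𝓕 T) H := by
  obtain ⟨S, hS⟩ := (memLp_one_iff_integrable.2 hH).exists_represents
  rw [hT.eq_of_ae_eq (hS.fourierInv hH) hg, FourierTransform.fourier_fourierInv_eq]
  exact hS

/-- Both spectra represent the Fourier transform of one and the same distribution. -/
theorem ae_eq_of_fourierInv_ae_eq {G : Rd d → ℂ} (hH : Integrable H) (hG : Integrable G)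
    (h : 𝓕⁻ H =ᵐ[volume] 𝓕⁻ G) : H =ᵐ[volume] G := by
  obtain ⟨S, hS⟩ := (memLp_top_fourierInv hH).exists_represents
  exact (hS.fourier_of_ae_eq hH .rfl).ae_eq (hS.fourier_of_ae_eq hG h)

/-- The Laplacian is the Fourier multiplier `-(2π)² |ν|²`; multiplying the transform by `|ν|²` means
moving this factor onto the test function. -/
theorem Represents.laplacian (hT : Represents T (𝓕⁻ H)) (hH : Integrable H)
    (hH2 : Integrable (fun ν => ((‖ν‖ ^ 2 : ℝ) : ℂ) * H ν)) :
    Represents (Δ T)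
      (fun x => (-(2 * Real.pi) ^ 2 : ℂ) * (𝓕⁻ fun ν => ((‖ν‖ ^ 2 : ℝ) : ℂ) * H ν) x) := by
  have hF := hT.fourier_of_ae_eq hH .rfl
  have hg : (fun x : Rd d => ((‖x‖ ^ 2 : ℝ) : ℂ)).HasTemperateGrowth := by
    fun_prop
  have h1 : Represents (TemperedDistribution.smulLeftCLM ℂ (fun x : Rd d => ((‖x‖ ^ 2 : ℝ) : ℂ))
      (𝓕 T)) (fun ν => ((‖ν‖ ^ 2 : ℝ) : ℂ) * H ν) := by
    refine ⟨hH2.1, fun φ => ?_⟩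
    have := hF.2 (SchwartzMap.smulLeftCLM ℂ (fun x : Rd d => ((‖x‖ ^ 2 : ℝ) : ℂ)) φ)
    simp only [SchwartzMap.smulLeftCLM_apply_apply hg, smul_eq_mul] at this
    have e (ν : Rd d) : φ ν * (((‖ν‖ ^ 2 : ℝ) : ℂ) * H ν) = ((‖ν‖ ^ 2 : ℝ) : ℂ) * φ ν * H ν := by
      ring
    simp only [e]
    exact this
  have h2 := (h1.fourierInv hH2).const_smul (-(2 * Real.pi) ^ 2 : ℂ)
  convert h2 using 1
  rw [TemperedDistribution.laplacian_eq_fourierMultiplierCLM,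
    TemperedDistribution.fourierMultiplierCLM_apply]
  ext φ
  simp

end Fourier

/-! ### The spectral Barron space through inverse Fourier transforms of integrable functions -/

/-- The weight `(1 + |2πν|²)^{s/2}` of the spectral Barron norm, in Mathlib's frequency variable. -/
noncomputable def barronWeight {d : ℕ} (s : ℝ) (ν : Rd d) : ℝ :=
  (1 + ‖(2 * Real.pi) • ν‖ ^ 2) ^ (s / 2)

section Weight

variable {d : ℕ}

theorem barronWeight_pos (s : ℝ) (ν : Rd d) : 0 < barronWeight s ν := by
  unfold barronWeight; positivity

theorem barronWeight_ne_zero (s : ℝ) (ν : Rd d) : (barronWeight s ν : ℂ) ≠ 0 :=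
  Complex.ofReal_ne_zero.2 (barronWeight_pos s ν).ne'

theorem continuous_barronWeight (s : ℝ) : Continuous (barronWeight s : Rd d → ℝ) := by
  unfold barronWeight
  refine Continuous.rpow_const (by fun_prop) fun ν => Or.inl ?_
  positivity

theorem one_le_barronWeight {s : ℝ} (hs : 0 ≤ s) (ν : Rd d) : 1 ≤ barronWeight s ν :=
  Real.one_le_rpow (by nlinarith [sq_nonneg ‖(2 * Real.pi) • ν‖]) (by linarith)

theorem inv_barronWeight_le_one {s : ℝ} (hs : 0 ≤ s) (ν : Rd d) : (barronWeight s ν)⁻¹ ≤ 1 :=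
  inv_le_one_of_one_le₀ (one_le_barronWeight hs ν)

theorem norm_smul_two_pi_sq (ν : Rd d) :
    ‖(2 * Real.pi) • ν‖ ^ 2 = (2 * Real.pi) ^ 2 * ‖ν‖ ^ 2 := by
  rw [norm_smul, mul_pow, Real.norm_eq_abs, sq_abs]

theorem barronWeight_add_two (s : ℝ) (ν : Rd d) :
    barronWeight (s + 2) ν = (1 + (2 * Real.pi) ^ 2 * ‖ν‖ ^ 2) * barronWeight s ν := by
  unfold barronWeight
  rw [norm_smul_two_pi_sq, show (s + 2) / 2 = s / 2 + 1 by ring,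
    Real.rpow_add_one (by positivity), mul_comm]

/-- Peetre's inequality. -/
theorem barronWeight_add_le {s : ℝ} (hs : 0 ≤ s) (ξ η : Rd d) :
    barronWeight s (ξ + η) ≤ 2 ^ (s / 2) * (barronWeight s ξ * barronWeight s η) := by
  unfold barronWeight
  rw [← Real.mul_rpow (by positivity) (by positivity), ← Real.mul_rpow (by positivity)
    (by positivity)]
  refine Real.rpow_le_rpow (by positivity) ?_ (by linarith)
  rw [smul_add]
  set a := (2 * Real.pi) • ξ
  set b := (2 * Real.pi) • η
  have h := norm_add_le a b
  have h2 : ‖a + b‖ ^ 2 ≤ (‖a‖ + ‖b‖) ^ 2 := pow_le_pow_left₀ (norm_nonneg _) h 2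
  nlinarith [sq_nonneg (‖a‖ - ‖b‖), mul_nonneg (sq_nonneg ‖a‖) (sq_nonneg ‖b‖)]

end Weight

/-- `H` is the Fourier transform of `g`, in Mathlib's normalization, and it is integrable against
the weight of the spectral Barron norm. -/
def IsBarronSpectrum {d : ℕ} (s : ℝ) (g : Rd d → ℝ) (H : Rd d → ℂ) : Prop :=
  Integrable (fun ν => (barronWeight s ν : ℂ) * H ν) ∧
    (fun x => (g x : ℂ)) =ᵐ[volume] 𝓕⁻ H

section BarronNorm

variable {d : ℕ} {s : ℝ} {g : Rd d → ℝ} {H : Rd d → ℂ}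

/-- The substitution `ξ = 2πν`. It needs no measurability of `F`, because the dilation is a
measurable equivalence. -/
theorem lintegral_comp_two_pi_smul (F : Rd d → ℝ≥0∞) :
    ∫⁻ ν, ENNReal.ofReal ((2 * Real.pi) ^ d) * F ((2 * Real.pi) • ν) = ∫⁻ ξ, F ξ := by
  have h0 : (2 * Real.pi : ℝ) ≠ 0 := by positivity
  have h := Measure.map_addHaar_smul (volume : Measure (Rd d)) h0
  have h1 : ∫⁻ ν, F ((2 * Real.pi) • ν) =
      ENNReal.ofReal |((2 * Real.pi) ^ d)⁻¹| * ∫⁻ ξ, F ξ := by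
    simp only [finrank_euclideanSpace, Fintype.card_fin] at h
    rw [← smul_eq_mul (ENNReal.ofReal _) (∫⁻ ξ, F ξ), ← lintegral_smul_measure, ← h]
    exact (lintegral_map_equiv F (Homeomorph.smulOfNeZero (2 * Real.pi : ℝ) h0 :
      Rd d ≃ₜ Rd d).toMeasurableEquiv).symm
  rw [lintegral_const_mul' _ _ ENNReal.ofReal_ne_top, h1, ← mul_assoc,
    ← ENNReal.ofReal_mul (by positivity), abs_of_pos (by positivity),
    mul_inv_cancel₀ (by positivity), ENNReal.ofReal_one, one_mul]

theorem lintegral_barron_eq (s : ℝ) (h : Rd d → ℂ) :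
    ∫⁻ ξ, ‖h ξ‖ₑ * ENNReal.ofReal ((1 + ‖ξ‖ ^ 2) ^ (s / 2)) =
      ∫⁻ ν, ‖(barronWeight s ν : ℂ) * ((((2 * Real.pi) ^ d : ℝ) : ℂ) *
        h ((2 * Real.pi) • ν))‖ₑ := by
  rw [← lintegral_comp_two_pi_smul]
  refine lintegral_congr fun ν => ?_
  have e1 : ‖((barronWeight s ν : ℝ) : ℂ)‖ₑ = ENNReal.ofReal (barronWeight s ν) := by
    rw [← ofReal_norm, Complex.norm_real, Real.norm_of_nonneg (barronWeight_pos s ν).le]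
  have e2 : ‖(((2 * Real.pi) ^ d : ℝ) : ℂ)‖ₑ = ENNReal.ofReal ((2 * Real.pi) ^ d) := by
    rw [← ofReal_norm, Complex.norm_real, Real.norm_of_nonneg (by positivity)]
  rw [enorm_mul, enorm_mul, e1, e2, barronWeight]
  ring

theorem integrable_of_barronWeight_mul (hs : 0 ≤ s)
    (hH : Integrable (fun ν => (barronWeight s ν : ℂ) * H ν)) : Integrable H := by
  have h1 : H = fun ν => ((barronWeight s ν)⁻¹ : ℂ) * ((barronWeight s ν : ℂ) * H ν) := by
    ext ν
    rw [inv_mul_cancel_left₀ (barronWeight_ne_zero s ν)]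
  rw [h1]
  refine hH.bdd_mul (c := 1) ?_ (.of_forall fun ν => ?_)
  · refine Continuous.aestronglyMeasurable ?_
    exact (Complex.continuous_ofReal.comp (continuous_barronWeight s)).inv₀
      (barronWeight_ne_zero s)
  · rw [norm_inv, Complex.norm_real, Real.norm_of_nonneg (barronWeight_pos s ν).le]
    exact inv_barronWeight_le_one hs ν

theorem IsBarronSpectrum.integrable (hs : 0 ≤ s) (hg : IsBarronSpectrum s g H) :
    Integrable H :=
  integrable_of_barronWeight_mul hs hg.1

theorem IsBarronSpectrum.memLp_top (hs : 0 ≤ s) (hg : IsBarronSpectrum s g H) :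
    MemLp (fun x => (g x : ℂ)) ∞ volume :=
  (memLp_congr_ae hg.2).2 (memLp_top_fourierInv (hg.integrable hs))

theorem IsBarronSpectrum.mono {t : ℝ} (hst : s ≤ t) (hg : IsBarronSpectrum t g H) :
    IsBarronSpectrum s g H := by
  refine ⟨?_, hg.2⟩
  have h1 : (fun ν => (barronWeight s ν : ℂ) * H ν) = fun ν =>
      ((barronWeight s ν : ℂ) * (barronWeight t ν : ℂ)⁻¹) * ((barronWeight t ν : ℂ) * H ν) := by
    ext ν
    rw [mul_assoc, inv_mul_cancel_left₀ (barronWeight_ne_zero t ν)]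
  rw [h1]
  refine hg.1.bdd_mul (c := 1) ?_ (.of_forall fun ν => ?_)
  · refine Continuous.aestronglyMeasurable ?_
    exact (Complex.continuous_ofReal.comp (continuous_barronWeight s)).mul
      ((Complex.continuous_ofReal.comp (continuous_barronWeight t)).inv₀ (barronWeight_ne_zero t))
  · rw [norm_mul, norm_inv, Complex.norm_real, Complex.norm_real,
      Real.norm_of_nonneg (barronWeight_pos s ν).le, Real.norm_of_nonneg (barronWeight_pos t ν).le,
      ← div_eq_mul_inv, div_le_one (barronWeight_pos t ν)]
    exact Real.rpow_le_rpow_of_exponent_le (by nlinarith [sq_nonneg ‖(2 * Real.pi) • ν‖])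
      (by linarith)

theorem exists_isFourierTransform_of_ae_eq (hH : Integrable H)
    (hg : (fun x => (g x : ℂ)) =ᵐ[volume] 𝓕⁻ H) :
    ∃ h : Rd d → ℂ, IsFourierTransform g h ∧
      ∀ ν, (((2 * Real.pi) ^ d : ℝ) : ℂ) * h ((2 * Real.pi) • ν) = H ν := by
  have h0 : (((2 * Real.pi) ^ d : ℝ) : ℂ) ≠ 0 := Complex.ofReal_ne_zero.2 (by positivity)
  have h1 : ∀ ν, (((2 * Real.pi) ^ d : ℝ) : ℂ) * ((((2 * Real.pi) ^ d : ℝ) : ℂ)⁻¹ *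
      H ((2 * Real.pi)⁻¹ • ((2 * Real.pi) • ν))) = H ν := by
    intro ν
    rw [mul_inv_cancel_left₀ h0, inv_smul_smul₀ (by positivity)]
  -- The passage from Mathlib's normalization back to that of the statement: `ĝ(ξ) = (2π)^{-d} H(ξ /
  -- 2π)`.
  refine ⟨fun ξ => (((2 * Real.pi) ^ d : ℝ) : ℂ)⁻¹ * H ((2 * Real.pi)⁻¹ • ξ), ?_, h1⟩
  obtain ⟨T, hT⟩ := ((memLp_congr_ae hg).2 (memLp_top_fourierInv hH)).exists_represents
  refine ⟨T, hT, ?_⟩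
  simp only [h1]
  exact hT.fourier_of_ae_eq hH hg

/-- Uniqueness of the Fourier transform leaves one value in the infimum, and `H` rescaled shows that
it is attained. -/
theorem IsBarronSpectrum.barronNorm_eq (hs : 0 ≤ s) (hg : IsBarronSpectrum s g H) :
    barronNorm s g = ∫⁻ ν, ‖(barronWeight s ν : ℂ) * H ν‖ₑ := by
  refine le_antisymm ?_ (le_iInf₂ fun h hh => ?_)
  · obtain ⟨h, hh, e⟩ := exists_isFourierTransform_of_ae_eq (hg.integrable hs) hg.2
    refine (iInf₂_le h hh).trans (le_of_eq ?_)
    rw [lintegral_barron_eq]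
    simp only [e]
  · obtain ⟨T, hT, hF⟩ := hh
    rw [lintegral_barron_eq]
    refine le_of_eq (lintegral_congr_ae ?_)
    filter_upwards [hF.ae_eq (hT.fourier_of_ae_eq (hg.integrable hs) hg.2)] with ν hν
    rw [hν]

theorem IsBarronSpectrum.mem_barronSpace (hs : 0 ≤ s) (hg : IsBarronSpectrum s g H) :
    g ∈ BarronSpace d s := by
  change barronNorm s g < ⊤
  rw [hg.barronNorm_eq hs]
  exact hg.1.2

theorem exists_isBarronSpectrum (hs : 0 ≤ s) (hg : g ∈ BarronSpace d s) :
    ∃ H : Rd d → ℂ, IsBarronSpectrum s g H := by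
  obtain ⟨h, hh⟩ := iInf_lt_iff.1 (show barronNorm s g < ⊤ from hg)
  obtain ⟨⟨T, hT, hF⟩, hlt⟩ := iInf_lt_iff.1 hh
  rw [lintegral_barron_eq] at hlt
  refine ⟨fun ν => (((2 * Real.pi) ^ d : ℝ) : ℂ) * h ((2 * Real.pi) • ν), ?_⟩
  have h1 : Integrable (fun ν => (barronWeight s ν : ℂ) *
      ((((2 * Real.pi) ^ d : ℝ) : ℂ) * h ((2 * Real.pi) • ν))) :=
    ⟨(Complex.continuous_ofReal.comp (continuous_barronWeight s)).aestronglyMeasurable.mul hF.1,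
      hlt⟩
  exact ⟨h1, hT.ae_eq_fourierInv hF (integrable_of_barronWeight_mul hs h1)⟩

end BarronNorm

/-! ### Finite rank perturbations of the identity -/

section FiniteRank

variable {E : Type*} [NormedAddCommGroup E] [NormedSpace ℂ E]

/-- The range of `F` is invariant and finite-dimensional, so `1 + F` is surjective on it. A solution
`r` there of `r + F r = F g` gives the preimage `g - r` of `g`. -/
theorem surjective_id_add_of_finiteDimensional_range (F : E →ₗ[ℂ] E)
    [FiniteDimensional ℂ F.range] (hinj : Function.Injective (LinearMap.id + F : E →ₗ[ℂ] E)) :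
    Function.Surjective (LinearMap.id + F : E →ₗ[ℂ] E) := by
  have hmem : ∀ x ∈ F.range, (LinearMap.id + F : E →ₗ[ℂ] E) x ∈ F.range := fun x hx =>
    F.range.add_mem hx ⟨x, rfl⟩
  have hsurj : Function.Surjective ((LinearMap.id + F : E →ₗ[ℂ] E).restrict hmem) := by
    rw [← LinearMap.injective_iff_surjective]
    intro x y hxy
    exact Subtype.ext (hinj (congrArg Subtype.val hxy))
  intro g
  obtain ⟨r, hr⟩ := hsurj ⟨F g, g, rfl⟩
  have hr' : (r : E) + F r = F g := congrArg Subtype.val hr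
  refine ⟨g - r, ?_⟩
  simp only [LinearMap.add_apply, LinearMap.id_apply, map_sub]
  rw [← hr']
  abel

/-- If `T` is within distance less than one of a finite rank operator and `1 + T` is injective,
then `1 + T` is surjective. -/
theorem surjective_one_add_of_norm_sub_lt_one [CompleteSpace E] (T F : E →L[ℂ] E)
    [hF : FiniteDimensional ℂ F.range] (hTF : ‖T - F‖ < 1)
    (hinj : Function.Injective (1 + T : E →L[ℂ] E)) :
    Function.Surjective (1 + T : E →L[ℂ] E) := by
  obtain ⟨u, hu⟩ : IsUnit (1 + (T - F)) := by
    have := isUnit_one_sub_of_norm_lt_one (x := -(T - F)) (by rwa [norm_neg])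
    rwa [sub_neg_eq_add] at this
  set L : E →L[ℂ] E := ↑u⁻¹
  have hL1 : ∀ x, L (x + (T - F) x) = x := fun x => by
    have : L * (1 + (T - F)) = 1 := by rw [← hu]; exact u.inv_mul
    exact congrArg (· x) this
  have hL2 : ∀ x, L x + (T - F) (L x) = x := fun x => by
    have : (1 + (T - F)) * L = 1 := by rw [← hu]; exact u.mul_inv
    exact congrArg (· x) this
  -- With `L` the Neumann inverse of `1 + (T - F)`, this is `L (1 + T) = 1 + L F`, an identity plus
  -- finite rank; `L` is injective, so both injectivity and surjectivity transfer.
  have key : ∀ x, x + L (F x) = L ((1 + T) x) := fun x => by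
    have : (1 + T) x = (x + (T - F) x) + F x := by simp; abel
    rw [this, map_add, hL1]
  let G : E →ₗ[ℂ] E := L.toLinearMap ∘ₗ F.toLinearMap
  have : FiniteDimensional ℂ G.range := by
    have : G.range = F.range.map L.toLinearMap := LinearMap.range_comp _ _
    rw [this]
    infer_instance
  have hLinj : Function.Injective L := fun x y hxy => by rw [← hL2 x, ← hL2 y, hxy]
  have hG : Function.Injective (LinearMap.id + G : E →ₗ[ℂ] E) := by
    intro x y hxy
    have hxy' : x + L (F x) = y + L (F y) := hxy
    rw [key, key] at hxy'
    exact hinj (hLinj hxy')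
  intro y
  obtain ⟨x, hx⟩ := surjective_id_add_of_finiteDimensional_range G hG (L y)
  have hx' : x + L (F x) = L y := hx
  rw [key] at hx'
  exact ⟨x, hLinj hx'⟩

end FiniteRank

/-! ### Operators on `L¹` given by bounded vector-valued kernels -/

namespace MeasureTheory.L1

variable {X E : Type*} [MeasurableSpace X] {μ : Measure X}
  [NormedAddCommGroup E] [NormedSpace ℂ E]

theorem integrable_smul_of_bounded {Φ : X → E} (hΦ : AEStronglyMeasurable Φ μ) {C : ℝ}
    (hC : ∀ x, ‖Φ x‖ ≤ C) (k : Lp ℂ 1 μ) : Integrable (fun x => k x • Φ x) μ :=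
  (L1.integrable_coeFn k).smul_bdd C hΦ (.of_forall hC)

/-- The operator `k ↦ ∫ k(x) Φ(x) dμ(x)` on `L¹`. -/
noncomputable def kernelOp (Φ : X → E) (hΦ : AEStronglyMeasurable Φ μ) (C : ℝ)
    (hC : ∀ x, ‖Φ x‖ ≤ C) : Lp ℂ 1 μ →L[ℂ] E :=
  LinearMap.mkContinuous
    { toFun := fun k => ∫ x, k x • Φ x ∂μ
      map_add' := fun k l => by
        rw [← MeasureTheory.integral_add (integrable_smul_of_bounded hΦ hC k)
          (integrable_smul_of_bounded hΦ hC l)]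
        refine integral_congr_ae ?_
        filter_upwards [Lp.coeFn_add k l] with x hx
        rw [hx, Pi.add_apply, add_smul]
      map_smul' := fun c k => by
        rw [RingHom.id_apply, ← MeasureTheory.integral_smul]
        refine integral_congr_ae ?_
        filter_upwards [Lp.coeFn_smul c k] with x hx
        rw [hx, Pi.smul_apply, smul_assoc] }
    C fun k => by
      have h1 : Integrable (fun x => C * ‖k x‖) μ := (L1.integrable_coeFn k).norm.const_mul C
      refine (norm_integral_le_of_norm_le h1 (.of_forall fun x => ?_)).trans (le_of_eq ?_)
      · rw [norm_smul, mul_comm]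
        exact mul_le_mul_of_nonneg_right (hC x) (norm_nonneg _)
      · rw [MeasureTheory.integral_const_mul, L1.norm_eq_integral_norm]

theorem kernelOp_apply (Φ : X → E) (hΦ : AEStronglyMeasurable Φ μ) (C : ℝ)
    (hC : ∀ x, ‖Φ x‖ ≤ C) (k : Lp ℂ 1 μ) : kernelOp Φ hΦ C hC k = ∫ x, k x • Φ x ∂μ := rfl

/-- The operator is linear in its kernel and its norm is at most the supremum of the kernel. Uniform
approximation of kernels is therefore norm approximation of operators. -/
theorem norm_kernelOp_sub_le {Φ Ψ : X → E} (hΦ : AEStronglyMeasurable Φ μ)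
    (hΨ : AEStronglyMeasurable Ψ μ) {C D ε : ℝ} (hC : ∀ x, ‖Φ x‖ ≤ C) (hD : ∀ x, ‖Ψ x‖ ≤ D)
    (hε : 0 ≤ ε) (h : ∀ x, ‖Φ x - Ψ x‖ ≤ ε) :
    ‖kernelOp Φ hΦ C hC - kernelOp Ψ hΨ D hD‖ ≤ ε := by
  refine ContinuousLinearMap.opNorm_le_bound _ hε fun k => ?_
  have e : (kernelOp Φ hΦ C hC - kernelOp Ψ hΨ D hD) k =
      kernelOp (fun x => Φ x - Ψ x) (hΦ.sub hΨ) ε h k := by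
    rw [sub_apply, kernelOp_apply, kernelOp_apply, kernelOp_apply,
      ← MeasureTheory.integral_sub (integrable_smul_of_bounded hΦ hC k) (integrable_smul_of_bounded hΨ hD k)]
    simp only [smul_sub]
  rw [e]
  exact LinearMap.mkContinuous_norm_le' _ _ |>.trans (by simp [hε]) |> fun h' =>
    (ContinuousLinearMap.le_opNorm _ k).trans (mul_le_mul_of_nonneg_right h' (norm_nonneg _))

theorem finiteDimensional_range_kernelOp [CompleteSpace E] {Φ : X → E}
    (hΦ : AEStronglyMeasurable Φ μ) {C : ℝ} (hC : ∀ x, ‖Φ x‖ ≤ C) (hfin : (Set.range Φ).Finite) :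
    FiniteDimensional ℂ (kernelOp Φ hΦ C hC).range := by
  let S := Submodule.span ℂ (Set.range Φ)
  have hS : FiniteDimensional ℂ S := FiniteDimensional.span_of_finite ℂ hfin
  have hcl : IsClosed (S : Set E) := Submodule.closed_of_finiteDimensional S
  have hle : (kernelOp Φ hΦ C hC).range ≤ S := by
    rintro _ ⟨k, rfl⟩
    change ∫ x, k x • Φ x ∂μ ∈ S
    -- A continuous projection onto the span of the values fixes the integrand and commutes with the
    -- integral, so the integral stays in the span.
    obtain ⟨p, hp⟩ := Submodule.ClosedComplemented.of_finiteDimensional S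
    have h := (S.subtypeL ∘L p).integral_comp_comm (integrable_smul_of_bounded hΦ hC k)
    have h2 : ∀ x, (S.subtypeL ∘L p) (k x • Φ x) = k x • Φ x := fun x =>
      congrArg Subtype.val (hp ⟨k x • Φ x,
        S.smul_mem _ (Submodule.subset_span (Set.mem_range_self x))⟩)
    simp only [h2] at h
    rw [h]
    exact (p _).2
  exact Submodule.finiteDimensional_of_le hle

end MeasureTheory.L1

/-- `Φ` is within `ε` of zero off a compact set, whose image has a finite `ε`-net. Sending `Φ x` to
the nearest point among the net and zero gives the simple function. -/
theorem exists_simpleFunc_norm_sub_le_of_tendsto_cocompact {X E : Type*} [TopologicalSpace X]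
    [MeasurableSpace X] [OpensMeasurableSpace X] [NormedAddCommGroup E] {Φ : X → E}
    (hΦ : Continuous Φ) (h0 : Tendsto Φ (cocompact X) (𝓝 0)) {ε : ℝ} (hε : 0 < ε) :
    ∃ σ : SimpleFunc X E, ∀ x, ‖Φ x - σ x‖ ≤ ε := by
  borelize E
  obtain ⟨K, hK, hKΦ⟩ := mem_cocompact.1 (h0 (Metric.ball_mem_nhds 0 hε))
  obtain ⟨t, -, htf, ht⟩ := (hK.image hΦ).finite_cover_balls hε
  let l := htf.toFinset.toList
  -- Zero is put at index 0, for the points outside `K`; the net then occupies the indices `1` to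
  -- `l.length`, which `nearestPt e l.length` includes.
  let e : ℕ → E := fun n => (0 :: l).getD n 0
  refine ⟨(SimpleFunc.nearestPt e l.length).comp Φ hΦ.measurable, fun x => ?_⟩
  have hne : ∃ n ≤ l.length, dist (e n) (Φ x) ≤ ε := by
    by_cases hx : x ∈ K
    · obtain ⟨y, hy, hxy⟩ := Set.mem_iUnion₂.1 (ht (Set.mem_image_of_mem Φ hx))
      have hyl : y ∈ l := by simpa [l] using hy
      obtain ⟨n, hn, rfl⟩ := List.mem_iff_getElem.1 hyl
      refine ⟨n + 1, hn, ?_⟩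
      have : e (n + 1) = l[n] := by simp [e, hn]
      rw [this, dist_comm]
      exact (Metric.mem_ball.1 hxy).le
    · refine ⟨0, Nat.zero_le _, ?_⟩
      have : e 0 = 0 := by simp [e]
      rw [this, dist_comm]
      exact (Metric.mem_ball.1 (hKΦ hx)).le
  obtain ⟨n, hn, hd⟩ := hne
  have h := SimpleFunc.edist_nearestPt_le e (Φ x) hn
  rw [edist_dist, edist_dist, ENNReal.ofReal_le_ofReal_iff dist_nonneg] at h
  rw [← dist_eq_norm, dist_comm]
  exact h.trans hd

/-- For a continuous kernel that vanishes at infinity, injectivity of `1 + T` implies its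
surjectivity. -/
theorem MeasureTheory.L1.surjective_one_add_kernelOp {X : Type*} [TopologicalSpace X]
    [MeasurableSpace X] [OpensMeasurableSpace X] {μ : Measure X}
    {Φ : X → Lp ℂ 1 μ} (hΦ : Continuous Φ) (hΦm : AEStronglyMeasurable Φ μ)
    (h0 : Tendsto Φ (cocompact X) (𝓝 0)) {C : ℝ} (hC : ∀ x, ‖Φ x‖ ≤ C)
    (hinj : Function.Injective (1 + kernelOp Φ hΦm C hC : Lp ℂ 1 μ →L[ℂ] Lp ℂ 1 μ)) :
    Function.Surjective (1 + kernelOp Φ hΦm C hC : Lp ℂ 1 μ →L[ℂ] Lp ℂ 1 μ) := by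
  obtain ⟨σ, hσ⟩ := exists_simpleFunc_norm_sub_le_of_tendsto_cocompact hΦ h0
    (ε := 1 / 2) (by norm_num)
  obtain ⟨D, hD⟩ := σ.exists_forall_norm_le
  have := finiteDimensional_range_kernelOp (μ := μ) σ.aestronglyMeasurable hD σ.finite_range
  refine surjective_one_add_of_norm_sub_lt_one _ (kernelOp σ σ.aestronglyMeasurable D hD)
    (lt_of_le_of_lt (norm_kernelOp_sub_le hΦm _ hC hD (by norm_num) hσ) (by norm_num)) hinj

/-! ### Multiplication and twisted convolution operators on `L¹` -/

/-- Multiplication by a bounded continuous function on `L¹(ℝᵈ)`. -/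
noncomputable def mulOp {d : ℕ} (m : BoundedContinuousFunction (Rd d) ℂ) :
    Lp ℂ 1 (volume : Measure (Rd d)) →L[ℂ] Lp ℂ 1 (volume : Measure (Rd d)) :=
  have hm (k : Lp ℂ 1 (volume : Measure (Rd d))) : Integrable (fun ν => m ν * k ν) :=
    (L1.integrable_coeFn k).bdd_mul m.continuous.aestronglyMeasurable (.of_forall m.norm_coe_le_norm)
  LinearMap.mkContinuous
    { toFun := fun k => (hm k).toL1
      map_add' := fun k l => by
        rw [← Integrable.toL1_add, Integrable.toL1_eq_toL1_iff]
        filter_upwards [Lp.coeFn_add k l] with ν hν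
        rw [hν, Pi.add_apply, Pi.add_apply, mul_add]
      map_smul' := fun c k => by
        rw [RingHom.id_apply, ← Integrable.toL1_smul', Integrable.toL1_eq_toL1_iff]
        filter_upwards [Lp.coeFn_smul c k] with ν hν
        rw [hν, Pi.smul_apply, Pi.smul_apply, smul_eq_mul, smul_eq_mul, mul_left_comm] }
    ‖m‖ fun k => by
      rw [LinearMap.coe_mk, AddHom.coe_mk, L1.norm_of_fun_eq_integral_norm,
        L1.norm_eq_integral_norm, ← integral_const_mul]
      refine integral_mono (hm k).norm ((L1.integrable_coeFn k).norm.const_mul _) fun ν => ?_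
      rw [norm_mul]
      exact mul_le_mul_of_nonneg_right (m.norm_coe_le_norm ν) (norm_nonneg _)

section MulOp

variable {d : ℕ} (m : BoundedContinuousFunction (Rd d) ℂ)
  (k : Lp ℂ 1 (volume : Measure (Rd d)))

theorem coeFn_mulOp : mulOp m k =ᵐ[volume] fun ν => m ν * k ν :=
  Integrable.coeFn_toL1 ((L1.integrable_coeFn k).bdd_mul m.continuous.aestronglyMeasurable
    (.of_forall m.norm_coe_le_norm))

theorem norm_mulOp_le {C : ℝ} (hC : ∀ ν, ‖m ν‖ ≤ C) : ‖mulOp m k‖ ≤ C * ‖k‖ := by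
  rw [L1.norm_eq_integral_norm, L1.norm_eq_integral_norm, ← integral_const_mul]
  refine integral_mono_ae (L1.integrable_coeFn _).norm
    ((L1.integrable_coeFn k).norm.const_mul _) ?_
  filter_upwards [coeFn_mulOp m k] with ν hν
  rw [hν, norm_mul]
  exact mul_le_mul_of_nonneg_right (hC ν) (norm_nonneg _)

theorem norm_mulOp_sub (m' : BoundedContinuousFunction (Rd d) ℂ) :
    ‖mulOp m k - mulOp m' k‖ = ∫ ν, ‖m ν * k ν - m' ν * k ν‖ := by
  rw [L1.norm_eq_integral_norm]
  refine integral_congr_ae ?_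
  filter_upwards [coeFn_mulOp m k, coeFn_mulOp m' k, Lp.coeFn_sub (mulOp m k) (mulOp m' k)]
    with ν h1 h2 h3
  rw [h3, Pi.sub_apply, h1, h2]

/-- Bounded pointwise convergence of multipliers gives strong convergence, by domination with `2 C
‖k‖`; uniform convergence is not needed. -/
theorem tendsto_mulOp {ι : Type*} {l : Filter ι} [l.IsCountablyGenerated]
    {m : BoundedContinuousFunction (Rd d) ℂ} {f : ι → BoundedContinuousFunction (Rd d) ℂ} {C : ℝ}
    (hC : ∀ i ν, ‖f i ν‖ ≤ C) (hf : ∀ ν, Tendsto (fun i => f i ν) l (𝓝 (m ν))) :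
    Tendsto (fun i => mulOp (f i) k) l (𝓝 (mulOp m k)) := by
  rcases l.eq_or_neBot with rfl | _
  · exact tendsto_bot
  have hmC : ∀ ν, ‖m ν‖ ≤ C := fun ν =>
    le_of_tendsto (hf ν).norm (.of_forall fun i => hC i ν)
  rw [tendsto_iff_norm_sub_tendsto_zero]
  simp only [norm_mulOp_sub]
  have h0 : (0 : ℝ) = ∫ _ : Rd d, (0 : ℝ) := by simp
  rw [h0]
  refine tendsto_integral_filter_of_dominated_convergence (fun ν => 2 * C * ‖k ν‖)
    (.of_forall fun i => ?_) (.of_forall fun i => .of_forall fun ν => ?_)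
    ((L1.integrable_coeFn k).norm.const_mul _) (.of_forall fun ν => ?_)
  · exact (((f i).continuous.aestronglyMeasurable.mul (Lp.aestronglyMeasurable k)).sub
      (m.continuous.aestronglyMeasurable.mul (Lp.aestronglyMeasurable k))).norm
  · rw [norm_norm, ← sub_mul, norm_mul]
    refine mul_le_mul_of_nonneg_right ((norm_sub_le _ _).trans ?_) (norm_nonneg _)
    linarith [hC i ν, hmC ν]
  · have := (((hf ν).mul_const (k ν)).sub_const (m ν * k ν)).norm
    simpa using this

end MulOp

/-- Translation by `η` on `L¹(ℝᵈ)`. -/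
noncomputable def translateL1 {d : ℕ} (η : Rd d) (k : Lp ℂ 1 (volume : Measure (Rd d))) :
    Lp ℂ 1 (volume : Measure (Rd d)) :=
  Lp.compMeasurePreserving (fun ξ => ξ - η) (measurePreserving_sub_right volume η) k

section Translate

variable {d : ℕ} (k : Lp ℂ 1 (volume : Measure (Rd d)))

theorem coeFn_translateL1 (η : Rd d) : translateL1 η k =ᵐ[volume] fun ξ => k (ξ - η) :=
  Lp.coeFn_compMeasurePreserving _ _

theorem norm_translateL1 (η : Rd d) : ‖translateL1 η k‖ = ‖k‖ :=
  Lp.norm_compMeasurePreserving _ _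

theorem continuous_translateL1 : Continuous fun η => translateL1 η k := by
  let g : C(Rd d, C(Rd d, Rd d)) :=
    (ContinuousMap.mk (fun a : Rd d × Rd d => a.2 - a.1) (by fun_prop)).curry
  exact (continuous_const (y := k)).compMeasurePreservingLp g.continuous
    (fun η => measurePreserving_sub_right volume η) (by norm_num)

end Translate

/-! ### Convolution conjugated by the Barron weight. -/

section Twisted

variable {d : ℕ} {s : ℝ}

/-- The ratio of weights `w(ξ) / (w(ξ - η) w(η))`, bounded by Peetre's inequality. -/
noncomputable def peetreRatio (hs : 0 ≤ s) (η : Rd d) : BoundedContinuousFunction (Rd d) ℂ :=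
  .ofNormedAddCommGroup
    (fun ξ => ((barronWeight s ξ / (barronWeight s (ξ - η) * barronWeight s η) : ℝ) : ℂ))
    (by
      have h1 := continuous_barronWeight (d := d) s
      refine Complex.continuous_ofReal.comp (h1.div (by fun_prop) fun ξ => ?_)
      exact (mul_pos (barronWeight_pos _ _) (barronWeight_pos _ _)).ne')
    (2 ^ (s / 2)) fun ξ => by
      have h1 := barronWeight_pos s ξ
      have h2 := barronWeight_pos s η
      have h3 := barronWeight_pos s (ξ - η)
      have h := barronWeight_add_le hs (ξ - η) η
      rw [sub_add_cancel] at h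
      rw [Complex.norm_real, Real.norm_of_nonneg (by positivity), div_le_iff₀ (by positivity)]
      exact h

theorem peetreRatio_apply (hs : 0 ≤ s) (η ξ : Rd d) : peetreRatio hs η ξ =
    ((barronWeight s ξ / (barronWeight s (ξ - η) * barronWeight s η) : ℝ) : ℂ) := rfl

theorem norm_peetreRatio_le (hs : 0 ≤ s) (η ξ : Rd d) : ‖peetreRatio hs η ξ‖ ≤ 2 ^ (s / 2) := by
  have h1 := barronWeight_pos s ξ
  have h2 := barronWeight_pos s η
  have h3 := barronWeight_pos s (ξ - η)
  have h := barronWeight_add_le hs (ξ - η) η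
  rw [sub_add_cancel] at h
  rw [peetreRatio_apply, Complex.norm_real, Real.norm_of_nonneg (by positivity),
    div_le_iff₀ (by positivity)]
  exact h

theorem continuous_peetreRatio (hs : 0 ≤ s) (ξ : Rd d) :
    Continuous fun η => peetreRatio hs η ξ := by
  have h1 := continuous_barronWeight (d := d) s
  refine Complex.continuous_ofReal.comp (continuous_const.div (by fun_prop) fun η => ?_)
  exact (mul_pos (barronWeight_pos _ _) (barronWeight_pos _ _)).ne'

/-- The kernel `η ↦ (ξ ↦ w(ξ) y(ξ - η) / (w(ξ - η) w(η)))` of the convolution with `y / w`, seen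
on `L¹` after multiplication by the weight `w`. -/
noncomputable def twistedKernel (hs : 0 ≤ s) (y : Lp ℂ 1 (volume : Measure (Rd d))) (η : Rd d) :
    Lp ℂ 1 (volume : Measure (Rd d)) :=
  mulOp (peetreRatio hs η) (translateL1 η y)

variable (hs : 0 ≤ s) (y : Lp ℂ 1 (volume : Measure (Rd d)))

theorem norm_twistedKernel_le (η : Rd d) : ‖twistedKernel hs y η‖ ≤ 2 ^ (s / 2) * ‖y‖ := by
  rw [← norm_translateL1 y η]
  exact norm_mulOp_le _ _ (norm_peetreRatio_le hs η)

/-- Near `η₀` the change is split in two: the multiplier moves on the fixed translate of `y`, where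
convergence is dominated, and the translate moves in norm under uniformly bounded multipliers. -/
theorem continuous_twistedKernel : Continuous (twistedKernel hs y) := by
  refine continuous_iff_continuousAt.2 fun η₀ => ?_
  have h1 : Tendsto (fun η => mulOp (peetreRatio hs η) (translateL1 η₀ y)) (𝓝 η₀)
      (𝓝 (mulOp (peetreRatio hs η₀) (translateL1 η₀ y))) :=
    tendsto_mulOp _ (norm_peetreRatio_le hs) fun ξ => (continuous_peetreRatio hs ξ).tendsto η₀
  have h2 : Tendsto (fun η => mulOp (peetreRatio hs η) (translateL1 η y - translateL1 η₀ y))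
      (𝓝 η₀) (𝓝 0) := by
    refine squeeze_zero_norm (fun η => norm_mulOp_le _ _ (norm_peetreRatio_le hs η)) ?_
    have := ((continuous_translateL1 y).tendsto η₀).sub_const (translateL1 η₀ y)
    simpa using this.norm.const_mul (2 ^ (s / 2))
  have h3 := h2.add h1
  rw [zero_add] at h3
  refine h3.congr fun η => ?_
  rw [← map_add, sub_add_cancel, twistedKernel]

/-- This is the source of compactness. Translating back by `η` fixes `y` and turns `m` into `m(· +
η)`, which tends to zero pointwise and boundedly; the Peetre ratio costs only a constant. -/
theorem tendsto_mulOp_twistedKernel {m : BoundedContinuousFunction (Rd d) ℂ}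
    (hm : Tendsto m (cocompact (Rd d)) (𝓝 0)) :
    Tendsto (fun η => mulOp m (twistedKernel hs y η)) (cocompact (Rd d)) (𝓝 0) := by
  have : (cocompact (Rd d)).IsCountablyGenerated := by
    rw [← Metric.cobounded_eq_cocompact, ← comap_norm_atTop]
    infer_instance
  let mT (η : Rd d) : BoundedContinuousFunction (Rd d) ℂ :=
    m.compContinuous ⟨fun ξ => ξ + η, by fun_prop⟩
  have h1 : Tendsto (fun η => mulOp (mT η) y) (cocompact (Rd d)) (𝓝 (mulOp 0 y)) := by
    refine tendsto_mulOp y (C := ‖m‖) (fun η ν => m.norm_coe_le_norm _) fun ν => ?_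
    exact hm.comp (Homeomorph.addLeft ν).isClosedEmbedding.tendsto_cocompact
  have h2 : mulOp (0 : BoundedContinuousFunction (Rd d) ℂ) y = 0 := by
    rw [Lp.eq_zero_iff_ae_eq_zero]
    filter_upwards [coeFn_mulOp 0 y] with ν hν
    rw [hν]
    simp
  rw [h2] at h1
  refine squeeze_zero_norm (a := fun η => 2 ^ (s / 2) * ‖mulOp (mT η) y‖) (fun η => ?_) ?_
  · have e : ‖mulOp (mT η) y‖ = ‖mulOp m (translateL1 η y)‖ := by
      rw [L1.norm_eq_integral_norm, L1.norm_eq_integral_norm,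
        ← integral_sub_right_eq_self (fun ν => ‖mulOp (mT η) y ν‖) η]
      refine integral_congr_ae ?_
      have hq := (measurePreserving_sub_right (volume : Measure (Rd d)) η).quasiMeasurePreserving
      filter_upwards [hq.ae (coeFn_mulOp (mT η) y), coeFn_mulOp m (translateL1 η y),
        coeFn_translateL1 y η] with ν h1 h2 h3
      rw [h1, h2, h3]
      simp [mT]
    have e2 : mulOp m (twistedKernel hs y η) =
        mulOp (peetreRatio hs η) (mulOp m (translateL1 η y)) := by
      refine Lp.ext ?_
      filter_upwards [coeFn_mulOp m (twistedKernel hs y η),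
        coeFn_mulOp (peetreRatio hs η) (translateL1 η y),
        coeFn_mulOp (peetreRatio hs η) (mulOp m (translateL1 η y)),
        coeFn_mulOp m (translateL1 η y)] with ν h1 h2 h3 h4
      rw [h1, h3, h4, twistedKernel, h2]
      ring
    rw [e, e2]
    exact norm_mulOp_le _ _ (norm_peetreRatio_le hs η)
  · simpa using h1.norm.const_mul (2 ^ (s / 2))

/-- The operator on `L¹` that corresponds to the convolution with `y / w` after multiplication by
the weight `w`. -/
noncomputable def twistedConvolution :
    Lp ℂ 1 (volume : Measure (Rd d)) →L[ℂ] Lp ℂ 1 (volume : Measure (Rd d)) :=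
  L1.kernelOp (twistedKernel hs y) (continuous_twistedKernel hs y).aestronglyMeasurable _
    (norm_twistedKernel_le hs y)

/-- The character `ν ↦ exp(2πi ν·x)` divided by the weight. -/
noncomputable def weightedChar (s : ℝ) (x ν : Rd d) : ℂ :=
  (Real.fourierChar (inner ℝ ν x) : ℂ) * ((barronWeight s ν)⁻¹ : ℂ)

theorem continuous_weightedChar (x : Rd d) : Continuous (weightedChar s x) := by
  refine Continuous.mul ?_ ((Complex.continuous_ofReal.comp (continuous_barronWeight s)).inv₀
    (barronWeight_ne_zero s))
  exact continuous_subtype_val.comp (Real.continuous_fourierChar.comp (by fun_prop))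

include hs in
theorem norm_weightedChar_le (x ν : Rd d) : ‖weightedChar s x ν‖ ≤ 1 := by
  rw [weightedChar, norm_mul, Circle.norm_coe, one_mul, norm_inv, Complex.norm_real,
    Real.norm_of_nonneg (barronWeight_pos s ν).le]
  exact inv_barronWeight_le_one hs ν

/-- Evaluation at `x` of the inverse Fourier transform of `k / w`. -/
noncomputable def evalOp (x : Rd d) : Lp ℂ 1 (volume : Measure (Rd d)) →L[ℂ] ℂ :=
  L1.kernelOp (weightedChar s x) (continuous_weightedChar x).aestronglyMeasurable 1
    (norm_weightedChar_le hs x)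

theorem evalOp_apply (x : Rd d) (k : Lp ℂ 1 (volume : Measure (Rd d))) :
    evalOp hs x k = (𝓕⁻ fun ν => ((barronWeight s ν)⁻¹ : ℂ) * k ν) x := by
  rw [evalOp, L1.kernelOp_apply, Real.fourierInv_eq]
  refine integral_congr_ae (.of_forall fun ν => ?_)
  simp only [weightedChar, smul_eq_mul, Circle.smul_def]
  ring

theorem weightedChar_mul_peetreRatio (x ξ η : Rd d) :
    peetreRatio hs η ξ * weightedChar s x ξ = weightedChar s x η * weightedChar s x (ξ - η) := by
  have h : Real.fourierChar (inner ℝ ξ x) =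
      Real.fourierChar (inner ℝ η x) * Real.fourierChar (inner ℝ (ξ - η) x) := by
    rw [← AddChar.map_add_eq_mul, ← inner_add_left, add_sub_cancel]
  rw [peetreRatio_apply, weightedChar, weightedChar, weightedChar, h]
  have h1 := barronWeight_ne_zero s ξ
  have h2 := barronWeight_ne_zero s η
  have h3 := barronWeight_ne_zero s (ξ - η)
  push_cast
  field_simp

/-- The translation of `y` by `η` produces a character in `η`, and the Peetre ratio is exactly what
makes the weights cancel. -/
theorem evalOp_twistedKernel (x η : Rd d) :
    evalOp hs x (twistedKernel hs y η) = weightedChar s x η * evalOp hs x y := by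
  rw [evalOp, L1.kernelOp_apply, L1.kernelOp_apply,
    ← integral_sub_right_eq_self (fun ν => y ν • weightedChar s x ν) η, ← integral_const_mul]
  refine integral_congr_ae ?_
  filter_upwards [coeFn_mulOp (peetreRatio hs η) (translateL1 η y), coeFn_translateL1 y η]
    with ξ h1 h2
  rw [twistedKernel, h1, h2, smul_eq_mul, smul_eq_mul, mul_right_comm,
    weightedChar_mul_peetreRatio]
  ring

/-- The convolution theorem. -/
theorem evalOp_twistedConvolution (x : Rd d) (k : Lp ℂ 1 (volume : Measure (Rd d))) :
    evalOp hs x (twistedConvolution hs y k) = evalOp hs x y * evalOp hs x k := by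
  rw [twistedConvolution, L1.kernelOp_apply, ← ContinuousLinearMap.integral_comp_comm]
  · simp only [map_smul, evalOp_twistedKernel]
    conv_rhs => rw [mul_comm, evalOp, L1.kernelOp_apply, ← integral_mul_const]
    refine integral_congr_ae (.of_forall fun ν => ?_)
    simp only [smul_eq_mul, mul_assoc]
    rfl
  · exact L1.integrable_smul_of_bounded
      (continuous_twistedKernel hs y).aestronglyMeasurable (norm_twistedKernel_le hs y) k

/-- If `m` vanishes at infinity and `1 + m A` is injective, where `A` is the twisted convolution
with `y`, then it is surjective. -/
theorem surjective_one_add_mulOp_comp_twistedConvolution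
    {m : BoundedContinuousFunction (Rd d) ℂ} (hm : Tendsto m (cocompact (Rd d)) (𝓝 0))
    (hinj : Function.Injective fun k => k + mulOp m (twistedConvolution hs y k)) :
    Function.Surjective fun k => k + mulOp m (twistedConvolution hs y k) := by
  have hc : Continuous fun η => mulOp m (twistedKernel hs y η) :=
    (mulOp m).continuous.comp (continuous_twistedKernel hs y)
  have hC : ∀ η, ‖mulOp m (twistedKernel hs y η)‖ ≤ ‖mulOp m‖ * (2 ^ (s / 2) * ‖y‖) := fun η =>
    ((mulOp m).le_opNorm _).trans
      (mul_le_mul_of_nonneg_left (norm_twistedKernel_le hs y η) (norm_nonneg _))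
  have e : (fun k => k + mulOp m (twistedConvolution hs y k)) =
      (1 + L1.kernelOp _ hc.aestronglyMeasurable _ hC :
        Lp ℂ 1 (volume : Measure (Rd d)) →L[ℂ] Lp ℂ 1 (volume : Measure (Rd d))) := by
    ext1 k
    change _ = k + L1.kernelOp _ _ _ _ k
    rw [twistedConvolution, L1.kernelOp_apply, L1.kernelOp_apply,
      ← ContinuousLinearMap.integral_comp_comm]
    · simp only [map_smul]
      rfl
    · exact L1.integrable_smul_of_bounded
        (continuous_twistedKernel hs y).aestronglyMeasurable (norm_twistedKernel_le hs y) k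
  rw [e] at hinj ⊢
  exact L1.surjective_one_add_kernelOp hc hc.aestronglyMeasurable
    (tendsto_mulOp_twistedKernel hs y hm) hC hinj

end Twisted

/-! ### A maximum principle through second differences -/

/-- The sum over the coordinate directions of the second difference quotients with step `t`. -/
noncomputable def secondDiff {d : ℕ} {E : Type*} [AddCommGroup E] [Module ℝ E] (v : Rd d → E)
    (x : Rd d) (t : ℝ) : E :=
  (t ^ 2)⁻¹ • ∑ k, (v (x + t • EuclideanSpace.single k 1) + v (x - t • EuclideanSpace.single k 1)
    - (2 : ℝ) • v x)

section MaximumPrinciple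

variable {d : ℕ}

theorem secondDiff_clm_comp {E F : Type*} [NormedAddCommGroup E] [NormedSpace ℝ E]
    [NormedAddCommGroup F] [NormedSpace ℝ F] (L : E →L[ℝ] F) (v : Rd d → E) (x : Rd d) (t : ℝ) :
    secondDiff (fun y => L (v y)) x t = L (secondDiff v x t) := by
  simp [secondDiff, map_sum]

/-- The parallelogram law. It makes the `secondDiff` of `ε ‖x‖²` exactly `2 d ε` for every step `t ≠
0`. -/
theorem norm_add_single_sq_add_norm_sub_single_sq (x : Rd d) (t : ℝ) (k : Fin d) :
    ‖x + t • EuclideanSpace.single k (1 : ℝ)‖ ^ 2 + ‖x - t • EuclideanSpace.single k (1 : ℝ)‖ ^ 2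
      = 2 * ‖x‖ ^ 2 + 2 * t ^ 2 := by
  have h := parallelogram_law_with_norm ℝ x (t • EuclideanSpace.single k (1 : ℝ))
  have h2 : ‖t • EuclideanSpace.single k (1 : ℝ)‖ ^ 2 = t ^ 2 := by
    rw [norm_smul, PiLp.norm_single, norm_one, mul_one, Real.norm_eq_abs, sq_abs]
  nlinarith

/-- A continuous function that vanishes at infinity is nonpositive, if its second differences
converge to a function that is nonnegative wherever the function is positive. -/
theorem nonpos_of_tendsto_secondDiff (hd : 0 < d) {v D : Rd d → ℝ} (hv : Continuous v)
    (h0 : Tendsto v (cocompact (Rd d)) (𝓝 0))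
    (hD : ∀ x, Tendsto (secondDiff v x) (𝓝[≠] 0) (𝓝 (D x)))
    (hpos : ∀ x, 0 < v x → 0 ≤ D x) (x : Rd d) : v x ≤ 0 := by
  by_contra! hx
  obtain ⟨xm, hxm⟩ : ∃ xm, 0 < v xm := ⟨x, hx⟩
  set M := v xm
  have h1 : ∀ᶠ y in cocompact (Rd d), v y < M / 2 := h0.eventually_lt_const (by linarith)
  rw [← Metric.cobounded_eq_cocompact, ← comap_norm_atTop] at h1
  obtain ⟨R₀, hR₀⟩ := (eventually_atTop.1 (eventually_comap.1 h1))
  set R := max R₀ 1 with hRdef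
  have hR1 : 1 ≤ R := le_max_right _ _
  have hR : ∀ y : Rd d, R ≤ ‖y‖ → v y < M / 2 := fun y hy =>
    hR₀ ‖y‖ ((le_max_left _ _).trans hy) y rfl
  -- The perturbation `ε ‖y‖²` is at most `M / 4` on the ball, so a maximizer of `φ` has `v ≥ 3M /
  -- 4`. As `v < M / 2` on the boundary, the maximizer is interior.
  set ε := M / (4 * R ^ 2) with hε
  have hε0 : 0 < ε := by positivity
  have hεR : ε * R ^ 2 = M / 4 := by rw [hε]; field_simp
  let φ : Rd d → ℝ := fun y => v y + ε * ‖y‖ ^ 2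
  have hφ : Continuous φ := by fun_prop
  obtain ⟨x₁, hx₁, hmax⟩ := (isCompact_closedBall (0 : Rd d) R).exists_isMaxOn
    ⟨0, by simp; linarith⟩ hφ.continuousOn
  have hxmR : ‖xm‖ < R := by
    by_contra! h
    have := hR xm h
    change M < M / 2 at this
    linarith
  have h2 : M ≤ φ x₁ := by
    have h3 : φ xm ≤ φ x₁ := hmax (by simpa using hxmR.le)
    have h4 : M ≤ φ xm := by
      change M ≤ M + ε * ‖xm‖ ^ 2
      have : 0 ≤ ε * ‖xm‖ ^ 2 := by positivity
      linarith
    linarith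
  have hx₁R : ‖x₁‖ ≤ R := by simpa using hx₁
  have hsq : ε * ‖x₁‖ ^ 2 ≤ M / 4 := by
    rw [← hεR]
    gcongr
  have hvx₁ : M / 2 < v x₁ := by
    have h3 : φ x₁ = v x₁ + ε * ‖x₁‖ ^ 2 := rfl
    linarith
  have hlt : ‖x₁‖ < R := by
    by_contra! h
    linarith [hR x₁ h]
  -- At the interior maximum the second differences of `φ` are nonpositive; removing the quadratic
  -- term makes those of `v` strictly negative, uniformly in small `t`. The limit then contradicts
  -- `0 ≤ D x₁`.
  have hev : ∀ᶠ t : ℝ in 𝓝[≠] 0, secondDiff v x₁ t ≤ -(2 * d * ε) := by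
    have hr : 0 < R - ‖x₁‖ := by linarith
    filter_upwards [mem_nhdsWithin_of_mem_nhds (Metric.ball_mem_nhds (0 : ℝ) hr),
      self_mem_nhdsWithin] with t ht ht0
    have ht0' : t ≠ 0 := ht0
    have htk : ∀ k : Fin d, ‖t • EuclideanSpace.single k (1 : ℝ)‖ < R - ‖x₁‖ := fun k => by
      rw [norm_smul, PiLp.norm_single, norm_one, mul_one]
      simpa using ht
    have hk : ∀ k : Fin d, v (x₁ + t • EuclideanSpace.single k 1) +
        v (x₁ - t • EuclideanSpace.single k 1) - (2 : ℝ) • v x₁ ≤ -(2 * ε * t ^ 2) := fun k => by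
      have e1 : φ (x₁ + t • EuclideanSpace.single k 1) ≤ φ x₁ := hmax (by
        rw [mem_closedBall_zero_iff]
        linarith [norm_add_le x₁ (t • EuclideanSpace.single k (1 : ℝ)), htk k])
      have e2 : φ (x₁ - t • EuclideanSpace.single k 1) ≤ φ x₁ := hmax (by
        rw [mem_closedBall_zero_iff]
        linarith [norm_sub_le x₁ (t • EuclideanSpace.single k (1 : ℝ)), htk k])
      have e3 := norm_add_single_sq_add_norm_sub_single_sq x₁ t k
      simp only [φ] at e1 e2
      rw [smul_eq_mul]
      have e4 : ε * ‖x₁ + t • EuclideanSpace.single k (1 : ℝ)‖ ^ 2 +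
          ε * ‖x₁ - t • EuclideanSpace.single k (1 : ℝ)‖ ^ 2 = ε * (2 * ‖x₁‖ ^ 2 + 2 * t ^ 2) := by
        rw [← e3]; ring
      linarith
    have hs := Finset.sum_le_sum fun k (_ : k ∈ Finset.univ) => hk k
    rw [Finset.sum_const, Finset.card_univ, Fintype.card_fin, nsmul_eq_mul] at hs
    have ht2 : 0 < t ^ 2 := by positivity
    rw [secondDiff, smul_eq_mul, inv_mul_le_iff₀ ht2]
    linarith
  have h3 := le_of_tendsto (hD x₁) hev
  have h4 := hpos x₁ (by linarith)
  have h5 : 0 < 2 * (d : ℝ) * ε := by positivity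
  linarith

/-- Since `V ≥ 0`, the limit `V v` has the sign of `v`, so the maximum principle applies to `v` and
to `-v`. -/
theorem eq_zero_of_tendsto_secondDiff (hd : 0 < d) {v V : Rd d → ℝ} (hv : Continuous v)
    (h0 : Tendsto v (cocompact (Rd d)) (𝓝 0)) (hV : ∀ x, 0 ≤ V x)
    (hD : ∀ x, Tendsto (secondDiff v x) (𝓝[≠] 0) (𝓝 (V x * v x))) (x : Rd d) : v x = 0 := by
  refine le_antisymm (nonpos_of_tendsto_secondDiff hd hv h0 hD
    (fun x hx => mul_nonneg (hV x) hx.le) x) ?_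
  have h := nonpos_of_tendsto_secondDiff hd (v := fun y => -v y) (D := fun y => -(V y * v y))
    hv.neg (by simpa using h0.neg) (fun x => ?_) (fun x hx => ?_) x
  · linarith
  · have e : secondDiff (fun y => -v y) x = fun t => -secondDiff v x t := by
      ext t
      exact secondDiff_clm_comp (-ContinuousLinearMap.id ℝ ℝ) v x t
    rw [e]
    exact (hD x).neg
  · nlinarith [hV x]

end MaximumPrinciple

/-! ### The pointwise Laplacian of an inverse Fourier transform. -/

section SecondDifferences

theorem abs_two_mul_cos_sub_two_le (θ : ℝ) : |2 * Real.cos θ - 2| ≤ θ ^ 2 := by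
  rw [abs_le]
  constructor <;> nlinarith [Real.one_sub_sq_div_two_le_cos (x := θ), Real.cos_le_one θ]

/-- From `2 cos(at) - 2 = -4 sin²(at/2)` and the derivative of `sin(at/2)` at zero. -/
theorem tendsto_two_mul_cos_sub_two_div_sq (a : ℝ) :
    Tendsto (fun t : ℝ => (t ^ 2)⁻¹ * (2 * Real.cos (a * t) - 2)) (𝓝[≠] 0) (𝓝 (-a ^ 2)) := by
  have h : HasDerivAt (fun t : ℝ => Real.sin (a / 2 * t)) (a / 2) 0 := by
    have := ((hasDerivAt_id (0 : ℝ)).const_mul (a / 2)).sin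
    simpa using this
  have h2 := ((hasDerivAt_iff_tendsto_slope.1 h).pow 2).const_mul (-4)
  have e : -4 * (a / 2) ^ 2 = -a ^ 2 := by ring
  rw [e] at h2
  refine h2.congr fun t => ?_
  have h3 : Real.cos (a * t) = 1 - 2 * Real.sin (a / 2 * t) ^ 2 := by
    rw [show a * t = 2 * (a / 2 * t) by ring, Real.cos_two_mul, Real.cos_sq']
    ring
  simp only [slope, vsub_eq_sub, sub_zero, mul_zero, Real.sin_zero, smul_eq_mul]
  rw [h3, mul_pow, inv_pow]
  ring

variable {d : ℕ} {H : Rd d → ℂ}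

theorem fourierChar_add_fourierChar_neg (θ : ℝ) :
    (Real.fourierChar θ : ℂ) + (Real.fourierChar (-θ) : ℂ) =
      ((2 * Real.cos (2 * Real.pi * θ) : ℝ) : ℂ) := by
  rw [Real.fourierChar_apply, Real.fourierChar_apply]
  push_cast
  rw [Complex.two_cos]
  congr 2
  ring

theorem integrable_fourierChar_mul (hH : Integrable H) (x : Rd d) :
    Integrable fun ν => (Real.fourierChar (inner ℝ ν x) : ℂ) * H ν := by
  refine hH.bdd_mul (c := 1) ?_ (.of_forall fun ν => ?_)
  · exact (continuous_subtype_val.comp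
      (Real.continuous_fourierChar.comp (by fun_prop))).aestronglyMeasurable
  · rw [Circle.norm_coe]

theorem fourierInv_eq_integral_mul (H : Rd d → ℂ) (x : Rd d) :
    (𝓕⁻ H) x = ∫ ν, (Real.fourierChar (inner ℝ ν x) : ℂ) * H ν := by
  rw [Real.fourierInv_eq]
  rfl

theorem secondDiff_fourierInv (hH : Integrable H) (x : Rd d) (t : ℝ) :
    secondDiff (𝓕⁻ H) x t = ∫ ν, ((∑ k, (t ^ 2)⁻¹ * (2 * Real.cos (2 * Real.pi * ν k * t) - 2) : ℝ)
      : ℂ) * ((Real.fourierChar (inner ℝ ν x) : ℂ) * H ν) := by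
  have hi := integrable_fourierChar_mul hH
  have hk : ∀ k : Fin d, (𝓕⁻ H) (x + t • EuclideanSpace.single k 1) +
      (𝓕⁻ H) (x - t • EuclideanSpace.single k 1) - (2 : ℝ) • (𝓕⁻ H) x =
      ∫ ν, ((2 * Real.cos (2 * Real.pi * ν k * t) - 2 : ℝ) : ℂ) *
        ((Real.fourierChar (inner ℝ ν x) : ℂ) * H ν) := fun k => by
    simp only [fourierInv_eq_integral_mul]
    rw [← integral_add (hi _) (hi _), ← integral_smul]
    refine (integral_sub ((hi _).add (hi _)) ((hi x).smul (2 : ℝ))).symm.trans ?_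
    refine integral_congr_ae (.of_forall fun ν => ?_)
    have e1 : inner ℝ ν (t • EuclideanSpace.single k (1 : ℝ)) = ν k * t := by
      simp [inner_smul_right, EuclideanSpace.inner_single_right, mul_comm]
    have e2 := fourierChar_add_fourierChar_neg (ν k * t)
    rw [← mul_assoc] at e2
    simp only [Pi.add_apply, Pi.smul_apply, sub_eq_add_neg, inner_add_right, inner_neg_right, e1,
      AddChar.map_add_eq_mul, Circle.coe_mul]
    rw [Complex.ofReal_add, ← e2]
    simp only [Complex.real_smul]
    push_cast
    ring
  rw [secondDiff, Finset.sum_congr rfl fun k _ => hk k, ← integral_finsetSum, ← integral_smul]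
  · refine integral_congr_ae (.of_forall fun ν => ?_)
    simp only [Complex.real_smul]
    rw [← Finset.sum_mul, ← Finset.mul_sum]
    push_cast
    ring
  · intro k _
    refine (hi x).bdd_mul (c := 4) ?_ (.of_forall fun ν => ?_)
    · exact Continuous.aestronglyMeasurable (by fun_prop)
    · rw [Complex.norm_real, Real.norm_eq_abs, abs_le]
      constructor <;> linarith [Real.neg_one_le_cos (2 * Real.pi * ν k * t),
        Real.cos_le_one (2 * Real.pi * ν k * t)]

/-- A second difference multiplies the spectrum by `(2 cos(2πν_k t) - 2) / t²`, which is at most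
`(2πν_k)²` in absolute value. Dominated convergence thus needs only the integrability of `|ν|² H`.
-/
theorem tendsto_secondDiff_fourierInv (hH : Integrable H)
    (hH2 : Integrable (fun ν => ((‖ν‖ ^ 2 : ℝ) : ℂ) * H ν)) (x : Rd d) :
    Tendsto (secondDiff (𝓕⁻ H) x) (𝓝[≠] 0)
      (𝓝 ((-(2 * Real.pi) ^ 2 : ℂ) * (𝓕⁻ fun ν => ((‖ν‖ ^ 2 : ℝ) : ℂ) * H ν) x)) := by
  have hfun : secondDiff (𝓕⁻ H) x = fun t => _ := funext fun t => secondDiff_fourierInv hH x t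
  have hlim : (-(2 * Real.pi) ^ 2 : ℂ) * (𝓕⁻ fun ν => ((‖ν‖ ^ 2 : ℝ) : ℂ) * H ν) x =
      ∫ ν, ((∑ k, -(2 * Real.pi * ν k) ^ 2 : ℝ) : ℂ) *
        ((Real.fourierChar (inner ℝ ν x) : ℂ) * H ν) := by
    rw [fourierInv_eq_integral_mul, ← integral_const_mul]
    refine integral_congr_ae (.of_forall fun ν => ?_)
    have : ∑ k, -(2 * Real.pi * ν k) ^ 2 = -(2 * Real.pi) ^ 2 * ‖ν‖ ^ 2 := by
      rw [EuclideanSpace.real_norm_sq_eq, Finset.mul_sum]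
      exact Finset.sum_congr rfl fun k _ => by ring
    simp only [this]
    push_cast
    ring
  rw [hfun, hlim]
  refine tendsto_integral_filter_of_dominated_convergence
    (fun ν => (2 * Real.pi) ^ 2 * ‖((‖ν‖ ^ 2 : ℝ) : ℂ) * H ν‖) (.of_forall fun t => ?_) ?_
    (hH2.norm.const_mul _) (.of_forall fun ν => ?_)
  · refine AEStronglyMeasurable.mul (Continuous.aestronglyMeasurable (by fun_prop))
      (integrable_fourierChar_mul hH x).1
  · filter_upwards [self_mem_nhdsWithin] with t ht
    refine .of_forall fun ν => ?_
    have ht2 : 0 < t ^ 2 := by have : t ≠ 0 := ht; positivity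
    rw [norm_mul, norm_mul, norm_mul, Circle.norm_coe, one_mul, ← mul_assoc, Complex.norm_real,
      Complex.norm_real, Real.norm_eq_abs, Real.norm_of_nonneg (by positivity)]
    refine mul_le_mul_of_nonneg_right ?_ (norm_nonneg _)
    rw [EuclideanSpace.real_norm_sq_eq, Finset.mul_sum]
    refine (Finset.abs_sum_le_sum_abs _ _).trans (Finset.sum_le_sum fun k _ => ?_)
    rw [abs_mul, abs_of_pos (inv_pos.2 ht2), inv_mul_le_iff₀ ht2]
    refine (abs_two_mul_cos_sub_two_le _).trans (le_of_eq (by ring))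
  · refine Tendsto.mul_const _ ?_
    refine (Complex.continuous_ofReal.tendsto _).comp ?_
    exact tendsto_finsetSum _ fun k _ => tendsto_two_mul_cos_sub_two_div_sq _

/-- The Riemann–Lebesgue lemma; for nonintegrable `H` the integral is zero by convention. -/
theorem tendsto_fourierInv_cocompact (H : Rd d → ℂ) :
    Tendsto (𝓕⁻ H) (cocompact (Rd d)) (𝓝 0) := by
  have : 𝓕⁻ H = fun x => 𝓕 H (-x) := by ext x; rw [Real.fourierInv_eq_fourier_neg]
  rw [this]
  exact (tendsto_integral_exp_inner_smul_cocompact H).comp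
    (Homeomorph.neg (Rd d)).isClosedEmbedding.tendsto_cocompact

/-- A real linear functional of `𝓕⁻ H` vanishes, if it solves `-Δ v + V v = 0` with `0 ≤ V`. -/
theorem clm_fourierInv_eq_zero (hd : 0 < d) (hH : Integrable H)
    (hH2 : Integrable (fun ν => ((‖ν‖ ^ 2 : ℝ) : ℂ) * H ν)) (L : ℂ →L[ℝ] ℝ) {V : Rd d → ℝ}
    (hV : ∀ x, 0 ≤ V x)
    (h : ∀ x, L (((2 * Real.pi) ^ 2 : ℂ) * (𝓕⁻ fun ν => ((‖ν‖ ^ 2 : ℝ) : ℂ) * H ν) x) +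
      V x * L ((𝓕⁻ H) x) = 0) (x : Rd d) : L ((𝓕⁻ H) x) = 0 := by
  refine eq_zero_of_tendsto_secondDiff hd (v := fun x => L ((𝓕⁻ H) x))
    ?_ ?_ hV (fun y => ?_) x
  · exact L.continuous.comp (continuous_fourierInv_of_integrable hH)
  · have := (L.continuous.tendsto 0).comp (tendsto_fourierInv_cocompact H)
    rwa [map_zero] at this
  · have h1 := (L.continuous.tendsto _).comp (tendsto_secondDiff_fourierInv hH hH2 y)
    have e : V y * L ((𝓕⁻ H) y) =
        L ((-(2 * Real.pi) ^ 2 : ℂ) * (𝓕⁻ fun ν => ((‖ν‖ ^ 2 : ℝ) : ℂ) * H ν) y) := by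
      rw [neg_mul, map_neg]
      linarith [h y]
    rw [e]
    exact h1.congr fun t => (secondDiff_clm_comp L (𝓕⁻ H) y t).symm

end SecondDifferences

/-! ### The Schrödinger equation in the frequency domain -/

section Resolvent

variable {d : ℕ} {α : ℝ}

theorem resolvent_denominator_pos (hα : 0 < α) (ν : Rd d) :
    0 < (2 * Real.pi) ^ 2 * ‖ν‖ ^ 2 + α := by positivity

/-- The symbol `1 / (|2πν|² + α)` of `(-Δ + α)⁻¹`. -/
noncomputable def resolventSymbol (d : ℕ) (hα : 0 < α) : BoundedContinuousFunction (Rd d) ℂ :=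
  .ofNormedAddCommGroup (fun ν => ((((2 * Real.pi) ^ 2 * ‖ν‖ ^ 2 + α)⁻¹ : ℝ) : ℂ))
    (Complex.continuous_ofReal.comp (Continuous.inv₀ (by fun_prop)
      fun ν => (resolvent_denominator_pos hα ν).ne'))
    α⁻¹ fun ν => by
      have := resolvent_denominator_pos hα ν
      rw [Complex.norm_real, Real.norm_of_nonneg (by positivity)]
      exact inv_anti₀ hα (by nlinarith [mul_nonneg (sq_nonneg (2 * Real.pi)) (sq_nonneg ‖ν‖)])

/-- The symbol `(1 + |2πν|²) / (|2πν|² + α)` of `(1 - Δ)(-Δ + α)⁻¹`. -/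
noncomputable def liftedResolventSymbol (d : ℕ) (hα : 0 < α) :
    BoundedContinuousFunction (Rd d) ℂ :=
  .ofNormedAddCommGroup
    (fun ν => (((1 + (2 * Real.pi) ^ 2 * ‖ν‖ ^ 2) / ((2 * Real.pi) ^ 2 * ‖ν‖ ^ 2 + α) : ℝ) : ℂ))
    (Complex.continuous_ofReal.comp (Continuous.div (by fun_prop) (by fun_prop)
      fun ν => (resolvent_denominator_pos hα ν).ne'))
    (1 + α⁻¹) fun ν => by
      have := resolvent_denominator_pos hα ν
      have h : 0 ≤ (2 * Real.pi) ^ 2 * ‖ν‖ ^ 2 := by positivity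
      rw [Complex.norm_real, Real.norm_of_nonneg (by positivity), div_le_iff₀ this]
      have h2 : α⁻¹ * α = 1 := inv_mul_cancel₀ hα.ne'
      have h3 : 0 ≤ α⁻¹ * ((2 * Real.pi) ^ 2 * ‖ν‖ ^ 2) := by positivity
      nlinarith

theorem resolventSymbol_apply (hα : 0 < α) (ν : Rd d) :
    resolventSymbol d hα ν = (((2 * Real.pi) ^ 2 * ‖ν‖ ^ 2 + α : ℝ) : ℂ)⁻¹ :=
  Complex.ofReal_inv _

theorem liftedResolventSymbol_apply (hα : 0 < α) (ν : Rd d) :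
    liftedResolventSymbol d hα ν =
      ((1 + (2 * Real.pi) ^ 2 * ‖ν‖ ^ 2 : ℝ) : ℂ) * resolventSymbol d hα ν := by
  rw [resolventSymbol_apply, ← Complex.ofReal_inv, ← Complex.ofReal_mul, ← div_eq_mul_inv]
  rfl

theorem tendsto_resolventSymbol (hα : 0 < α) :
    Tendsto (resolventSymbol d hα) (cocompact (Rd d)) (𝓝 0) := by
  have h1 : Tendsto (fun r : ℝ => ((2 * Real.pi) ^ 2 * r ^ 2 + α)⁻¹) atTop (𝓝 0) := by
    refine tendsto_inv_atTop_zero.comp (tendsto_atTop_add_const_right _ _ ?_)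
    exact (tendsto_pow_atTop two_ne_zero).const_mul_atTop (by positivity)
  have h2 := (Complex.continuous_ofReal.tendsto 0).comp
    (h1.comp (tendsto_norm_cocompact_atTop (E := Rd d)))
  rw [Complex.ofReal_zero] at h2
  exact h2

end Resolvent

/-! ### The equation in weighted L¹: gain of two orders and bijectivity. -/

section Frequency

variable {d : ℕ} {α s : ℝ} (hα : 0 < α) (hs : 0 ≤ s) (y : Lp ℂ 1 (volume : Measure (Rd d)))

/-- The operator `1 + (-Δ + α)⁻¹ W` in the frequency domain. -/
noncomputable def schrodingerOp :
    Lp ℂ 1 (volume : Measure (Rd d)) →L[ℂ] Lp ℂ 1 (volume : Measure (Rd d)) :=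
  1 + mulOp (resolventSymbol d hα) ∘L twistedConvolution hs y

theorem schrodingerOp_apply (k : Lp ℂ 1 (volume : Measure (Rd d))) :
    schrodingerOp hα hs y k = k + mulOp (resolventSymbol d hα) (twistedConvolution hs y k) := rfl

theorem schrodingerOp_eq_mulOp_iff (k l : Lp ℂ 1 (volume : Measure (Rd d))) :
    schrodingerOp hα hs y k = mulOp (resolventSymbol d hα) l ↔
      ∀ᵐ ν, (((2 * Real.pi) ^ 2 * ‖ν‖ ^ 2 + α : ℝ) : ℂ) * k ν + twistedConvolution hs y k ν
        = l ν := by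
  rw [schrodingerOp_apply, Lp.ext_iff]
  refine eventually_congr ?_
  filter_upwards [Lp.coeFn_add k (mulOp (resolventSymbol d hα) (twistedConvolution hs y k)),
    coeFn_mulOp (resolventSymbol d hα) (twistedConvolution hs y k),
    coeFn_mulOp (resolventSymbol d hα) l] with ν h1 h2 h3
  rw [h1, Pi.add_apply, h2, h3, resolventSymbol_apply]
  have h0 : (((2 * Real.pi) ^ 2 * ‖ν‖ ^ 2 + α : ℝ) : ℂ) ≠ 0 :=
    Complex.ofReal_ne_zero.2 (resolvent_denominator_pos hα ν).ne'
  rw [← mul_right_inj' h0, mul_add, mul_inv_cancel_left₀ h0, mul_inv_cancel_left₀ h0]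

/-- The gain of two orders of regularity: `(|2πν|² + α) k = l - A k` is solved for `k` and
multiplied by `1 + |2πν|²`, and the quotient of the two factors is bounded. -/
theorem lift_ae_eq_of_schrodingerOp_eq {k l : Lp ℂ 1 (volume : Measure (Rd d))}
    (h : schrodingerOp hα hs y k = mulOp (resolventSymbol d hα) l) :
    (fun ν => ((1 + (2 * Real.pi) ^ 2 * ‖ν‖ ^ 2 : ℝ) : ℂ) * k ν) =ᵐ[volume]
      mulOp (liftedResolventSymbol d hα) (l - twistedConvolution hs y k) := by
  filter_upwards [(schrodingerOp_eq_mulOp_iff hα hs y k l).1 h,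
    coeFn_mulOp (liftedResolventSymbol d hα) (l - twistedConvolution hs y k),
    Lp.coeFn_sub l (twistedConvolution hs y k)] with ν h1 h2 h3
  have h0 : (((2 * Real.pi) ^ 2 * ‖ν‖ ^ 2 + α : ℝ) : ℂ) ≠ 0 :=
    Complex.ofReal_ne_zero.2 (resolvent_denominator_pos hα ν).ne'
  rw [h2, h3, Pi.sub_apply, ← h1, add_sub_cancel_right, liftedResolventSymbol_apply,
    resolventSymbol_apply, mul_assoc, inv_mul_cancel_left₀ h0]

theorem integrable_lift_of_schrodingerOp_eq {k l : Lp ℂ 1 (volume : Measure (Rd d))}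
    (h : schrodingerOp hα hs y k = mulOp (resolventSymbol d hα) l) :
    Integrable fun ν => ((1 + (2 * Real.pi) ^ 2 * ‖ν‖ ^ 2 : ℝ) : ℂ) * k ν :=
  (L1.integrable_coeFn _).congr (lift_ae_eq_of_schrodingerOp_eq hα hs y h).symm

variable {y} {k : Lp ℂ 1 (volume : Measure (Rd d))}

/-- The unweighted spectrum of an element of the weighted space. -/
noncomputable def unweight (s : ℝ) (k : Lp ℂ 1 (volume : Measure (Rd d))) (ν : Rd d) : ℂ :=
  ((barronWeight s ν)⁻¹ : ℂ) * k ν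

theorem barronWeight_mul_unweight (k : Lp ℂ 1 (volume : Measure (Rd d))) (ν : Rd d) :
    (barronWeight s ν : ℂ) * unweight s k ν = k ν :=
  mul_inv_cancel_left₀ (barronWeight_ne_zero s ν) _

include hs in
theorem integrable_unweight (k : Lp ℂ 1 (volume : Measure (Rd d))) :
    Integrable (unweight s k) := by
  refine integrable_of_barronWeight_mul hs ?_
  simp only [barronWeight_mul_unweight]
  exact L1.integrable_coeFn k

theorem evalOp_eq_fourierInv_unweight (k : Lp ℂ 1 (volume : Measure (Rd d))) (x : Rd d) :
    evalOp hs x k = (𝓕⁻ (unweight s k)) x := evalOp_apply hs x k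

theorem unweight_toL1_ae_eq {H : Rd d → ℂ}
    (hH : Integrable (fun ν => (barronWeight s ν : ℂ) * H ν)) :
    unweight s hH.toL1 =ᵐ[volume] H := by
  filter_upwards [hH.coeFn_toL1] with ν hν
  rw [unweight, hν, inv_mul_cancel_left₀ (barronWeight_ne_zero s ν)]

theorem barronWeight_add_two_mul_unweight (k : Lp ℂ 1 (volume : Measure (Rd d))) (ν : Rd d) :
    (barronWeight (s + 2) ν : ℂ) * unweight s k ν =
      ((1 + (2 * Real.pi) ^ 2 * ‖ν‖ ^ 2 : ℝ) : ℂ) * k ν := by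
  rw [barronWeight_add_two, Complex.ofReal_mul, mul_assoc, barronWeight_mul_unweight]

include hs in
theorem integrable_norm_sq_mul {H : Rd d → ℂ}
    (hH : Integrable (fun ν => (barronWeight (s + 2) ν : ℂ) * H ν)) :
    Integrable (fun ν => ((‖ν‖ ^ 2 : ℝ) : ℂ) * H ν) := by
  refine (hH.norm.const_mul ((2 * Real.pi) ^ 2)⁻¹).mono' ?_ (.of_forall fun ν => ?_)
  · refine AEStronglyMeasurable.mul (Continuous.aestronglyMeasurable (by fun_prop))
      (integrable_of_barronWeight_mul (by linarith) hH).1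
  · rw [norm_mul, norm_mul, ← mul_assoc, Complex.norm_real, Complex.norm_real,
      Real.norm_of_nonneg (by positivity), Real.norm_of_nonneg (barronWeight_pos _ _).le]
    refine mul_le_mul_of_nonneg_right ?_ (norm_nonneg _)
    rw [le_inv_mul_iff₀ (by positivity), barronWeight_add_two]
    have h1 := one_le_barronWeight hs ν
    have h2 : 0 ≤ (2 * Real.pi) ^ 2 * ‖ν‖ ^ 2 := by positivity
    nlinarith

/-- The Fourier transform of `-Δ u + (α + W) u`. -/
theorem fourierInv_schrodinger (α : ℝ) {H : Rd d → ℂ}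
    (hH : Integrable (fun ν => (barronWeight (s + 2) ν : ℂ) * H ν))
    (hk : unweight s k =ᵐ[volume] H) (x : Rd d) :
    (𝓕⁻ fun ν => (((2 * Real.pi) ^ 2 * ‖ν‖ ^ 2 + α : ℝ) : ℂ) * H ν +
        unweight s (twistedConvolution hs y k) ν) x =
      ((2 * Real.pi) ^ 2 : ℂ) * (𝓕⁻ fun ν => ((‖ν‖ ^ 2 : ℝ) : ℂ) * H ν) x +
        (α + evalOp hs x y) * (𝓕⁻ H) x := by
  have hi1 := integrable_of_barronWeight_mul (by linarith) hH
  have hi2 := integrable_norm_sq_mul hs hH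
  have e1 : (𝓕⁻ H) x = evalOp hs x k := by
    rw [evalOp_eq_fourierInv_unweight]
    exact (Real.fourierInv_congr_ae hk x).symm
  have e2 := evalOp_twistedConvolution hs y x k
  rw [evalOp_eq_fourierInv_unweight, ← e1] at e2
  rw [add_mul, ← e2]
  simp only [fourierInv_eq_integral_mul]
  have i1 := integrable_fourierChar_mul hi1 x
  have i2 := integrable_fourierChar_mul hi2 x
  have i3 := integrable_fourierChar_mul (integrable_unweight hs (twistedConvolution hs y k)) x
  rw [← integral_const_mul, ← integral_const_mul, ← add_assoc,
    ← integral_add (i2.const_mul _) (i1.const_mul _)]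
  refine Eq.trans ?_ (integral_add ((i2.const_mul _).add (i1.const_mul _)) i3)
  refine integral_congr_ae (.of_forall fun ν => ?_)
  push_cast
  ring

theorem integrable_schrodinger (α : ℝ) {H : Rd d → ℂ}
    (hH : Integrable (fun ν => (barronWeight (s + 2) ν : ℂ) * H ν)) :
    Integrable fun ν => (((2 * Real.pi) ^ 2 * ‖ν‖ ^ 2 + α : ℝ) : ℂ) * H ν +
        unweight s (twistedConvolution hs y k) ν := by
  refine Integrable.add ?_ (integrable_unweight hs _)
  have := ((integrable_norm_sq_mul hs hH).const_mul ((2 * Real.pi) ^ 2 : ℂ)).add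
    ((integrable_of_barronWeight_mul (by linarith) hH).const_mul (α : ℂ))
  refine this.congr (.of_forall fun ν => ?_)
  simp only [Pi.add_apply]
  push_cast
  ring

/-- A solution of the frequency equation solves the equation pointwise in space. -/
theorem pointwise_of_schrodingerOp_eq {l : Lp ℂ 1 (volume : Measure (Rd d))}
    (h : schrodingerOp hα hs y k = mulOp (resolventSymbol d hα) l) (x : Rd d) :
    ((2 * Real.pi) ^ 2 : ℂ) * (𝓕⁻ fun ν => ((‖ν‖ ^ 2 : ℝ) : ℂ) * unweight s k ν) x +
        (α + evalOp hs x y) * (𝓕⁻ (unweight s k)) x = evalOp hs x l := by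
  have hH : Integrable (fun ν => (barronWeight (s + 2) ν : ℂ) * unweight s k ν) := by
    simp only [barronWeight_add_two_mul_unweight]
    exact integrable_lift_of_schrodingerOp_eq hα hs y h
  rw [← fourierInv_schrodinger hs α hH .rfl, evalOp_eq_fourierInv_unweight]
  refine Real.fourierInv_congr_ae ?_ x
  filter_upwards [(schrodingerOp_eq_mulOp_iff hα hs y k l).1 h] with ν hν
  rw [unweight, unweight, unweight, ← hν]
  ring

variable {V : Rd d → ℝ} (hd : 0 < d) (hV : ∀ x, 0 ≤ V x)
  (hy : ∀ x, (α : ℂ) + evalOp hs x y = V x)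

include hV hy hd in
/-- Solutions of the frequency equation inherit the vanishing of a real functional, such as the
imaginary part, from the right-hand side. -/
theorem clm_fourierInv_unweight_eq_zero {l : Lp ℂ 1 (volume : Measure (Rd d))}
    (h : schrodingerOp hα hs y k = mulOp (resolventSymbol d hα) l) (L : ℂ →L[ℝ] ℝ)
    (hL : ∀ x, L (evalOp hs x l) = 0) (x : Rd d) : L ((𝓕⁻ (unweight s k)) x) = 0 := by
  have hH : Integrable (fun ν => (barronWeight (s + 2) ν : ℂ) * unweight s k ν) := by
    simp only [barronWeight_add_two_mul_unweight]
    exact integrable_lift_of_schrodingerOp_eq hα hs y h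
  refine clm_fourierInv_eq_zero hd (integrable_unweight hs k) (integrable_norm_sq_mul hs hH) L hV
    (fun x => ?_) x
  -- The potential is real, so the real-linear `L` commutes with multiplication by it.
  rw [← hL x, ← pointwise_of_schrodingerOp_eq hα hs h x, hy, map_add, ← Complex.real_smul,
    map_smul, smul_eq_mul]

include hV hy hd in
-- The maximum principle kills the real and imaginary parts of `𝓕⁻ (k / w)`, and `𝓕⁻` is injective
-- on L¹.
theorem injective_schrodingerOp : Function.Injective (schrodingerOp hα hs y) := by
  rw [injective_iff_map_eq_zero]
  intro k hk
  have h : schrodingerOp hα hs y k = mulOp (resolventSymbol d hα) 0 := by rw [hk, map_zero]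
  have h0 (L : ℂ →L[ℝ] ℝ) := clm_fourierInv_unweight_eq_zero hα hs hd hV hy h L (by simp)
  have h1 : 𝓕⁻ (unweight s k) =ᵐ[volume] 𝓕⁻ (fun _ : Rd d => (0 : ℂ)) :=
    .of_forall fun x => by
      rw [fourierInv_eq_integral_mul (fun _ : Rd d => (0 : ℂ))]
      simp only [mul_zero, integral_zero]
      exact Complex.ext (h0 Complex.reCLM x) (h0 Complex.imCLM x)
  have h2 := ae_eq_of_fourierInv_ae_eq (integrable_unweight hs k) (integrable_zero _ _ _) h1
  rw [Lp.eq_zero_iff_ae_eq_zero]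
  filter_upwards [h2] with ν hν
  rw [← barronWeight_mul_unweight (s := s) k ν, hν]
  exact mul_zero _

include hV hy hd in
theorem bijective_schrodingerOp : Function.Bijective (schrodingerOp hα hs y) :=
  ⟨injective_schrodingerOp hα hs hd hV hy,
    surjective_one_add_mulOp_comp_twistedConvolution hs y (tendsto_resolventSymbol hα)
      (injective_schrodingerOp hα hs hd hV hy)⟩

end Frequency

/-! ### Solvability and regularity in spectral Barron spaces -/

section Solvability

variable {d : ℕ} {α s : ℝ} {V W f u : Rd d → ℝ} {HW F H : Rd d → ℂ}

namespace IsBarronSpectrum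

/-- The weighted Fourier transform as an element of `L¹`. -/
noncomputable def weighted (hu : IsBarronSpectrum s u H) : Lp ℂ 1 (volume : Measure (Rd d)) :=
  hu.1.toL1

theorem unweight_weighted_ae_eq (hu : IsBarronSpectrum s u H) :
    unweight s hu.weighted =ᵐ[volume] H :=
  unweight_toL1_ae_eq hu.1

theorem evalOp_weighted (hs : 0 ≤ s) (hu : IsBarronSpectrum s u H) (x : Rd d) :
    evalOp hs x hu.weighted = (𝓕⁻ H) x := by
  rw [evalOp_eq_fourierInv_unweight]
  exact Real.fourierInv_congr_ae hu.unweight_weighted_ae_eq x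

theorem weighted_congr {v : Rd d → ℝ} {G : Rd d → ℂ} (hu : IsBarronSpectrum s u H)
    (hv : IsBarronSpectrum s v G) (h : hu.weighted = hv.weighted) : u =ᵐ[volume] v := by
  have hHG : H =ᵐ[volume] G := by
    have h1 := hu.unweight_weighted_ae_eq
    rw [h] at h1
    exact h1.symm.trans hv.unweight_weighted_ae_eq
  have e : 𝓕⁻ H = 𝓕⁻ G := funext fun x => Real.fourierInv_congr_ae hHG x
  have h2 := hu.2
  rw [e] at h2
  filter_upwards [h2, hv.2] with x h3 h4
  exact_mod_cast h3.trans h4.symm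

theorem im_fourierInv_eq_zero (hs : 0 ≤ s) (hu : IsBarronSpectrum s u H) (x : Rd d) :
    ((𝓕⁻ H) x).im = 0 := by
  have hc := continuous_fourierInv_of_integrable (hu.integrable hs)
  have h : (fun x => ((𝓕⁻ H) x).im) =ᵐ[volume] fun _ => 0 := by
    filter_upwards [hu.2] with x hx
    rw [← hx, Complex.ofReal_im]
  exact congrFun ((Complex.continuous_im.comp hc).ae_eq_iff_eq volume continuous_const |>.1 h) x

theorem ae_eq_re (hu : IsBarronSpectrum s u H) : u =ᵐ[volume] fun x => ((𝓕⁻ H) x).re := by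
  filter_upwards [hu.2] with x hx
  rw [← hx, Complex.ofReal_re]

theorem barronNorm_eq_enorm_weighted (hs : 0 ≤ s) (hu : IsBarronSpectrum s u H) :
    barronNorm s u = ‖hu.weighted‖ₑ := by
  rw [hu.barronNorm_eq hs, Lp.enorm_def, eLpNorm_one_eq_lintegral_enorm]
  refine lintegral_congr_ae ?_
  filter_upwards [hu.1.coeFn_toL1] with ν hν
  rw [weighted, hν]

end IsBarronSpectrum

/-- The continuous representative of the potential is nonnegative everywhere. -/
theorem potential_nonneg (hs : 0 ≤ s) (hV : ∀ x, 0 ≤ V x) (hVW : ∀ x, V x = α + W x)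
    (hW : IsBarronSpectrum s W HW) (x : Rd d) : 0 ≤ α + ((𝓕⁻ HW) x).re := by
  have hc := continuous_fourierInv_of_integrable (hW.integrable hs)
  have hc' : Continuous fun x => α + ((𝓕⁻ HW) x).re :=
    continuous_const.add (Complex.continuous_re.comp hc)
  -- Nonnegativity is written as an equation between continuous functions, so that it passes from
  -- almost everywhere to everywhere.
  have h : (fun x => min (α + ((𝓕⁻ HW) x).re) 0) =ᵐ[volume] fun _ => 0 := by
    filter_upwards [hW.ae_eq_re] with x hx
    rw [← hx, ← hVW]
    exact min_eq_right (hV x)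
  have h2 := congrFun ((hc'.min continuous_const).ae_eq_iff_eq volume continuous_const |>.1 h) x
  exact min_eq_right_iff.1 h2

theorem potential_eq (hs : 0 ≤ s) (hW : IsBarronSpectrum s W HW) (x : Rd d) :
    (α : ℂ) + evalOp hs x hW.weighted = ((α + ((𝓕⁻ HW) x).re : ℝ) : ℂ) := by
  rw [hW.evalOp_weighted hs, Complex.ofReal_add]
  congr 1
  exact Complex.ext rfl (hW.im_fourierInv_eq_zero hs x)

theorem bijective_schrodingerOp_of_potential (hd : 0 < d) (hα : 0 < α) (hs : 0 ≤ s)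
    (hV : ∀ x, 0 ≤ V x) (hVW : ∀ x, V x = α + W x) (hW : IsBarronSpectrum s W HW) :
    Function.Bijective (schrodingerOp hα hs hW.weighted) :=
  bijective_schrodingerOp hα hs hd (potential_nonneg hs hV hVW hW) (potential_eq hs hW)

theorem ae_eq_potential_mul (hs : 0 ≤ s) (hVW : ∀ x, V x = α + W x)
    (hW : IsBarronSpectrum s W HW) (hu : IsBarronSpectrum (s + 2) u H) :
    (fun x => ((V x * u x : ℝ) : ℂ)) =ᵐ[volume]
      fun x => (α + evalOp hs x hW.weighted) * (𝓕⁻ H) x := by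
  filter_upwards [hW.2, hu.2] with x h1 h2
  rw [hW.evalOp_weighted hs, ← h1, ← h2, hVW]
  push_cast
  ring

theorem memLp_top_potential_mul (hs : 0 ≤ s) (hVW : ∀ x, V x = α + W x)
    (hW : IsBarronSpectrum s W HW) (hu : IsBarronSpectrum (s + 2) u H) :
    MemLp (fun x => ((V x * u x : ℝ) : ℂ)) ∞ volume := by
  have h1 := (hu.memLp_top (by linarith)).const_mul (α : ℂ)
  have h2 : MemLp (fun x => (W x : ℂ) * (u x : ℂ)) ∞ volume :=
    (hu.memLp_top (by linarith)).mul (hW.memLp_top hs)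
  refine (h1.add h2).ae_eq (.of_forall fun x => ?_)
  simp only [Pi.add_apply]
  rw [hVW]
  push_cast
  ring

theorem represents_schrodinger (hs : 0 ≤ s) (hVW : ∀ x, V x = α + W x)
    (hW : IsBarronSpectrum s W HW) (hu : IsBarronSpectrum (s + 2) u H)
    {k : Lp ℂ 1 (volume : Measure (Rd d))} (hk : unweight s k =ᵐ[volume] H)
    {U P : 𝓢'(Rd d, ℂ)} (hU : Represents U fun x => (u x : ℂ))
    (hP : Represents P fun x => ((V x * u x : ℝ) : ℂ)) :
    Represents (-(Δ U) + P)
      (𝓕⁻ fun ν => (((2 * Real.pi) ^ 2 * ‖ν‖ ^ 2 + α : ℝ) : ℂ) * H ν +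
        unweight s (twistedConvolution hs hW.weighted k) ν) := by
  have h1 := ((hU.congr_ae hu.2).laplacian (hu.integrable (by linarith))
    (integrable_norm_sq_mul hs hu.1)).neg
  refine (h1.add hP).congr_ae ?_
  filter_upwards [ae_eq_potential_mul hs hVW hW hu] with x hx
  rw [hx, fourierInv_schrodinger hs α hu.1 hk]
  ring

/-- Both sides say that the Fourier transform `G` of `-Δu + Vu` equals that of `f` almost
everywhere: the left by Fourier inversion, the right after division by the weight. -/
theorem solvesSchrodinger_iff (hα : 0 < α) (hs : 0 ≤ s) (hVW : ∀ x, V x = α + W x)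
    (hW : IsBarronSpectrum s W HW) (hf : IsBarronSpectrum s f F)
    (hu : IsBarronSpectrum (s + 2) u H) {k : Lp ℂ 1 (volume : Measure (Rd d))}
    (hk : unweight s k =ᵐ[volume] H) :
    SolvesSchrodinger V f u ↔
      schrodingerOp hα hs hW.weighted k = mulOp (resolventSymbol d hα) hf.weighted := by
  set G : Rd d → ℂ := fun ν => (((2 * Real.pi) ^ 2 * ‖ν‖ ^ 2 + α : ℝ) : ℂ) * H ν +
        unweight s (twistedConvolution hs hW.weighted k) ν with hG
  have hGi : Integrable G := integrable_schrodinger hs α hu.1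
  have key : schrodingerOp hα hs hW.weighted k = mulOp (resolventSymbol d hα) hf.weighted ↔
      G =ᵐ[volume] F := by
    rw [schrodingerOp_eq_mulOp_iff]
    refine eventually_congr ?_
    filter_upwards [hk, hf.unweight_weighted_ae_eq] with ν h1 h2
    change _ ↔ _ * H ν + _ = F ν
    rw [← h1, ← h2, ← barronWeight_mul_unweight (s := s) k ν,
      ← barronWeight_mul_unweight (s := s) hf.weighted ν,
      ← barronWeight_mul_unweight (s := s) (twistedConvolution hs hW.weighted k) ν,
      mul_left_comm, ← mul_add, mul_right_inj' (barronWeight_ne_zero s ν)]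
  rw [key]
  constructor
  · rintro ⟨U, P, S, hU, hP, hS, e⟩
    have h := represents_schrodinger hs hVW hW hu hk hU hP
    rw [e] at h
    exact ae_eq_of_fourierInv_ae_eq hGi (hf.integrable hs) ((h.ae_eq hS).trans hf.2)
  · intro hGF
    obtain ⟨U, hU⟩ := (hu.memLp_top (by linarith)).exists_represents
    obtain ⟨P, hP⟩ := (memLp_top_potential_mul hs hVW hW hu).exists_represents
    obtain ⟨S, hS⟩ := (hf.memLp_top hs).exists_represents
    refine ⟨U, P, S, hU, hP, hS,
      (represents_schrodinger hs hVW hW hu hk hU hP).eq_of_ae_eq hS ?_⟩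
    filter_upwards [hf.2] with x hx
    rw [hx]
    exact Real.fourierInv_congr_ae hGF x

theorem unweight_weighted_mono_ae_eq (hu : IsBarronSpectrum (s + 2) u H) :
    unweight s (hu.mono (by linarith : s ≤ s + 2)).weighted =ᵐ[volume] H :=
  IsBarronSpectrum.unweight_weighted_ae_eq _

theorem exists_unique_solution (hd : 0 < d) (hα : 0 < α) (hs : 0 ≤ s)
    (hV : ∀ x, 0 ≤ V x) (hVW : ∀ x, V x = α + W x) (hW : W ∈ BarronSpace d s)
    (hf : f ∈ BarronSpace d s) :
    ∃ u ∈ BarronSpace d (s + 2), SolvesSchrodinger V f u ∧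
      ∀ v ∈ BarronSpace d (s + 2), SolvesSchrodinger V f v → v =ᵐ[volume] u := by
  obtain ⟨HW, hW⟩ := exists_isBarronSpectrum hs hW
  obtain ⟨F, hf⟩ := exists_isBarronSpectrum hs hf
  obtain ⟨hinj, hsurj⟩ := bijective_schrodingerOp_of_potential hd hα hs hV hVW hW
  obtain ⟨k, hk⟩ := hsurj (mulOp (resolventSymbol d hα) hf.weighted)
  -- The imaginary part solves the homogeneous equation, because `V` and `f` are real, and so
  -- vanishes by the maximum principle.
  have hre (x : Rd d) : ((((𝓕⁻ (unweight s k)) x).re : ℝ) : ℂ) = (𝓕⁻ (unweight s k)) x := by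
    refine Complex.ext rfl (Eq.symm ?_)
    refine clm_fourierInv_unweight_eq_zero hα hs hd (potential_nonneg hs hV hVW hW)
      (potential_eq hs hW) hk Complex.imCLM (fun x => ?_) x
    rw [hf.evalOp_weighted hs]
    exact hf.im_fourierInv_eq_zero hs x
  have hu : IsBarronSpectrum (s + 2) (fun x => ((𝓕⁻ (unweight s k)) x).re) (unweight s k) := by
    refine ⟨?_, .of_forall hre⟩
    simp only [barronWeight_add_two_mul_unweight]
    exact integrable_lift_of_schrodingerOp_eq hα hs _ hk
  refine ⟨_, hu.mem_barronSpace (by linarith),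
    (solvesSchrodinger_iff hα hs hVW hW hf hu .rfl).2 hk, fun v hv hsol => ?_⟩
  obtain ⟨G, hv⟩ := exists_isBarronSpectrum (by linarith) hv
  have h1 := (solvesSchrodinger_iff hα hs hVW hW hf hv (unweight_weighted_mono_ae_eq hv)).1 hsol
  have h2 := (solvesSchrodinger_iff hα hs hVW hW hf hu (unweight_weighted_mono_ae_eq hu)).1
    ((solvesSchrodinger_iff hα hs hVW hW hf hu .rfl).2 hk)
  exact IsBarronSpectrum.weighted_congr _ _ (hinj (h1.trans h2.symm))

/-- The weighted spectrum of `u`, at order `s + 2`, is the image of that of `f` under the bounded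
operator `B = (1 + |2πν|²) m (1 - A S⁻¹ m)`, where `S = 1 + m A` is invertible by the bounded
inverse theorem. The constant is the norm of `B`. -/
theorem exists_regularityEstimate (hd : 0 < d) (hα : 0 < α) (hs : 0 ≤ s)
    (hV : ∀ x, 0 ≤ V x) (hVW : ∀ x, V x = α + W x) (hW : W ∈ BarronSpace d s) :
    ∃ C : ℝ≥0, RegularityEstimate V s C := by
  obtain ⟨HW, hW⟩ := exists_isBarronSpectrum hs hW
  obtain ⟨hinj, hsurj⟩ := bijective_schrodingerOp_of_potential hd hα hs hV hVW hW
  let S := ContinuousLinearEquiv.ofBijective (schrodingerOp hα hs hW.weighted)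
    (LinearMap.ker_eq_bot.2 hinj) (LinearMap.range_eq_top.2 hsurj)
  let B : Lp ℂ 1 (volume : Measure (Rd d)) →L[ℂ] Lp ℂ 1 (volume : Measure (Rd d)) :=
    mulOp (liftedResolventSymbol d hα) ∘L
      (1 - twistedConvolution hs hW.weighted ∘L S.symm.toContinuousLinearMap ∘L
        mulOp (resolventSymbol d hα))
  refine ⟨‖B‖₊, fun f hf u hu hsol => ?_⟩
  obtain ⟨F, hf⟩ := exists_isBarronSpectrum hs hf
  obtain ⟨H, hu⟩ := exists_isBarronSpectrum (by linarith) hu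
  set k := (hu.mono (by linarith : s ≤ s + 2)).weighted with hkdef
  have hk : unweight s k =ᵐ[volume] H := unweight_weighted_mono_ae_eq hu
  have h := (solvesSchrodinger_iff hα hs hVW hW hf hu hk).1 hsol
  have hkS : S.symm (mulOp (resolventSymbol d hα) hf.weighted) = k := by
    rw [← h]
    exact S.symm_apply_apply k
  have hB : hu.weighted = B hf.weighted := by
    have e : B hf.weighted = mulOp (liftedResolventSymbol d hα)
        (hf.weighted - twistedConvolution hs hW.weighted k) := by
      rw [← hkS]
      rfl
    rw [e]
    refine Lp.ext (hu.1.coeFn_toL1.trans (EventuallyEq.trans ?_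
      (lift_ae_eq_of_schrodingerOp_eq hα hs _ h)))
    filter_upwards [hk] with ν hν
    rw [← hν, barronWeight_add_two_mul_unweight]
  rw [hu.barronNorm_eq_enorm_weighted (by linarith), hf.barronNorm_eq_enorm_weighted hs, hB]
  simp only [enorm_eq_nnnorm]
  exact_mod_cast B.le_opNNNorm hf.weighted

end Solvability

/-! ### Approximation of means by averages of samples -/

section Sampling

variable {Ξ Z ι : Type*} [MeasurableSpace Ξ] [MeasurableSpace Z] [Fintype ι]
  {p : Measure Ξ} [IsProbabilityMeasure p] {ρ : Measure Z} [IsFiniteMeasure ρ]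

/-- Maurey's argument: a mean of functions of square norm at most `b` is approximated by averages
of `n` of these functions with square error at most `b / n`. -/
theorem exists_sample_sum_sq_le {Y : ι → Ξ → Z → ℝ}
    (hY : ∀ i, Measurable (Function.uncurry (Y i))) {D : ℝ} (hD : ∀ i ξ z, |Y i ξ z| ≤ D) {b : ℝ}
    (hb : ∀ ξ, ∑ i, ∫ z, Y i ξ z ^ 2 ∂ρ ≤ b) (n : ℕ) :
    ∃ ξ : Fin n → Ξ,
      ∑ i, ∫ z, (∑ j, Y i (ξ j) z - n * ∫ ζ, Y i ζ z ∂p) ^ 2 ∂ρ ≤ n * b := by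
  have hYm (i : ι) (ξ : Ξ) : Measurable (Y i ξ) := (hY i).comp measurable_prodMk_left
  set U : ι → Z → ℝ := fun i z => ∫ ζ, Y i ζ z ∂p with hU
  have hUm (i : ι) : Measurable (U i) := by
    have : StronglyMeasurable fun z => ∫ ζ, Function.uncurry (Y i) (ζ, z) ∂p :=
      (hY i).stronglyMeasurable.integral_prod_left'
    exact this.measurable
  have hUD (i : ι) (z : Z) : |U i z| ≤ D := by
    have := norm_integral_le_of_norm_le_const (μ := p) (f := fun ζ => Y i ζ z) (C := D)
      (.of_forall fun ζ => hD i ζ z)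
    simpa using this
  have hint {g : Z → ℝ} (hg : Measurable g) (C : ℝ) (hC : ∀ z, |g z| ≤ C) : Integrable g ρ :=
    Integrable.of_bound hg.aestronglyMeasurable C (.of_forall hC)
  induction n with
  | zero => exact ⟨Fin.elim0, by simp⟩
  | succ n ih =>
    obtain ⟨ξ, hξ⟩ := ih
    -- The error is kept as an unnormalized sum, so that each new sample adds at most `b` to its
    -- square norm.
    set S : ι → Z → ℝ := fun i z => ∑ j, Y i (ξ j) z - n * U i z with hS
    have hSm (i : ι) : Measurable (S i) :=
      (Finset.measurable_fun_sum _ fun j _ => hYm i (ξ j)).sub ((hUm i).const_mul _)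
    have hSD (i : ι) (z : Z) : |S i z| ≤ 2 * n * D := by
      have h1 : |∑ j, Y i (ξ j) z| ≤ n * D := by
        refine (Finset.abs_sum_le_sum_abs _ _).trans ?_
        refine (Finset.sum_le_sum fun j _ => hD i (ξ j) z).trans ?_
        simp
      have h2 : |(n : ℝ) * U i z| ≤ n * D := by
        rw [abs_mul, Nat.abs_cast]
        exact mul_le_mul_of_nonneg_left (hUD i z) (Nat.cast_nonneg n)
      calc |S i z| ≤ |∑ j, Y i (ξ j) z| + |(n : ℝ) * U i z| := abs_sub _ _
        _ ≤ 2 * n * D := by linarith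
    have hmul {g h : Z → ℝ} (hg : Measurable g) (hh : Measurable h) (C E : ℝ)
        (hC : ∀ z, |g z| ≤ C) (hE : ∀ z, |h z| ≤ E) : Integrable (fun z => g z * h z) ρ :=
      hint (hg.mul hh) (C * E) fun z => by
        rw [abs_mul]
        exact mul_le_mul (hC z) (hE z) (abs_nonneg _) ((abs_nonneg _).trans (hC z))
    have hTm (i : ι) : Measurable fun z => S i z - U i z := (hSm i).sub (hUm i)
    have hTD (i : ι) (z : Z) : |S i z - U i z| ≤ 2 * n * D + D :=
      (abs_sub _ _).trans (add_le_add (hSD i z) (hUD i z))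
    have hprod (i : ι) : Integrable
        (Function.uncurry fun ζ z => (S i z - U i z) * Y i ζ z) (p.prod ρ) := by
      refine Integrable.of_bound ?_ ((2 * n * D + D) * D) (.of_forall fun q => ?_)
      · exact (((hTm i).comp measurable_snd).mul (hY i)).aestronglyMeasurable
      · change |(S i q.2 - U i q.2) * Y i q.1 q.2| ≤ _
        rw [abs_mul]
        exact mul_le_mul (hTD i _) (hD i _ _) (abs_nonneg _) ((abs_nonneg _).trans (hTD i q.2))
    have hc : Integrable (fun ζ => ∑ i, ∫ z, (S i z - U i z) * Y i ζ z ∂ρ) p :=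
      integrable_finsetSum _ fun i _ => (hprod i).integral_prod_left
    -- Samples are chosen one at a time, without independence. The new error is `(S - U) + Y ζ`; its
    -- cross term has mean `∫ (S - U) U`, and some `ζ` does no worse. The square norm is then at
    -- most that of `S`, minus that of `U`, plus that of `Y ζ`.
    obtain ⟨ζ, hζ⟩ := exists_le_integral hc
    have hmean : ∫ ζ, ∑ i, ∫ z, (S i z - U i z) * Y i ζ z ∂ρ ∂p =
        ∑ i, ∫ z, (S i z - U i z) * U i z ∂ρ := by
      refine (integral_finsetSum _ fun i _ => (hprod i).integral_prod_left).trans ?_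
      refine Finset.sum_congr rfl fun i _ => ?_
      refine (integral_integral_swap (hprod i)).trans ?_
      simp only [integral_const_mul, hU]
    rw [hmean] at hζ
    refine ⟨Fin.cons ζ ξ, ?_⟩
    have hexp (i : ι) : ∫ z, (∑ j, Y i ((Fin.cons ζ ξ : Fin (n + 1) → Ξ) j) z -
        ((n + 1 : ℕ) : ℝ) * U i z) ^ 2 ∂ρ = ∫ z, S i z ^ 2 ∂ρ - ∫ z, U i z ^ 2 ∂ρ +
        2 * (∫ z, (S i z - U i z) * Y i ζ z ∂ρ - ∫ z, (S i z - U i z) * U i z ∂ρ) +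
        ∫ z, Y i ζ z ^ 2 ∂ρ := by
      have i1 : Integrable (fun z => S i z ^ 2) ρ := by
        simpa only [sq] using hmul (hSm i) (hSm i) _ _ (hSD i) (hSD i)
      have i2 : Integrable (fun z => U i z ^ 2) ρ := by
        simpa only [sq] using hmul (hUm i) (hUm i) _ _ (hUD i) (hUD i)
      have i3 : Integrable (fun z => Y i ζ z ^ 2) ρ := by
        simpa only [sq] using hmul (hYm i ζ) (hYm i ζ) _ _ (hD i ζ) (hD i ζ)
      have i4 := hmul (hTm i) (hYm i ζ) _ _ (hTD i) (hD i ζ)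
      have i5 := hmul (hTm i) (hUm i) _ _ (hTD i) (hUD i)
      have i6 : Integrable (fun z => S i z ^ 2 - U i z ^ 2) ρ := i1.sub i2
      have i7 : Integrable (fun z => 2 * ((S i z - U i z) * Y i ζ z - (S i z - U i z) * U i z)) ρ :=
        (i4.sub i5).const_mul 2
      rw [← integral_sub i1 i2, ← integral_sub i4 i5, ← integral_const_mul, ← integral_add i6 i7]
      refine Eq.trans ?_ (integral_add (i6.add i7) i3)
      refine integral_congr_ae (.of_forall fun z => ?_)
      simp only [Fin.sum_univ_succ, Fin.cons_zero, Fin.cons_succ, hS]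
      push_cast
      ring
    change ∑ i, ∫ z, (_ - ((n + 1 : ℕ) : ℝ) * U i z) ^ 2 ∂ρ ≤ _
    rw [Finset.sum_congr rfl fun i _ => hexp i]
    rw [Finset.sum_add_distrib, Finset.sum_add_distrib, Finset.sum_sub_distrib, ← Finset.mul_sum,
      Finset.sum_sub_distrib]
    have h0 : 0 ≤ ∑ i, ∫ z, U i z ^ 2 ∂ρ :=
      Finset.sum_nonneg fun i _ => integral_nonneg fun z => sq_nonneg _
    have h1 := hb ζ
    change ∑ i, ∫ z, S i z ^ 2 ∂ρ ≤ n * b at hξ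
    push_cast
    linarith

end Sampling

/-! ### Approximation by cosine networks -/

section WeakDerivative

variable {d : ℕ} {Ω : Set (Rd d)} {k : Fin d} {g g' h : Rd d → ℝ}

theorem HasWeakPartialDeriv.congr_ae (hg : HasWeakPartialDeriv Ω k g h) (e : g =ᵐ[volume] g') :
    HasWeakPartialDeriv Ω k g' h := by
  refine ⟨hg.1.congr (ae_restrict_of_ae e), hg.2.1, fun φ h1 h2 h3 => ?_⟩
  rw [← hg.2.2 φ h1 h2 h3]
  refine integral_congr_ae (ae_restrict_of_ae ?_)
  filter_upwards [e] with x hx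
  rw [hx]

theorem h1Norm_congr_ae (e : g =ᵐ[volume] g') : h1Norm Ω g = h1Norm Ω g' := by
  unfold h1Norm
  have e1 : ∫⁻ x in Ω, ‖g x‖ₑ ^ 2 = ∫⁻ x in Ω, ‖g' x‖ₑ ^ 2 := by
    refine lintegral_congr_ae (ae_restrict_of_ae ?_)
    filter_upwards [e] with x hx
    rw [hx]
  rw [e1]
  refine iInf_congr fun G => iInf_congr_Prop (forall_congr' fun k => ?_) fun _ => rfl
  exact ⟨fun h => h.congr_ae e, fun h => h.congr_ae e.symm⟩

/-- Integration by parts on the whole space: the test function and its derivative vanish outside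
`Ω`, so the integrals over `Ω` are global ones. -/
theorem ContDiff.hasWeakPartialDeriv (hg : ContDiff ℝ 1 g) (Ω : Set (Rd d)) (k : Fin d) :
    HasWeakPartialDeriv Ω k g fun x => fderiv ℝ g x (EuclideanSpace.single k 1) := by
  have hg' : Continuous fun x => fderiv ℝ g x (EuclideanSpace.single k 1) :=
    (hg.continuous_fderiv one_ne_zero).clm_apply continuous_const
  refine ⟨hg.continuous.locallyIntegrable.locallyIntegrableOn _,
    hg'.locallyIntegrable.locallyIntegrableOn _, fun φ hφ hc hΩ => ?_⟩
  have hφ' : Continuous fun x => fderiv ℝ φ x (EuclideanSpace.single k 1) :=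
    (hφ.continuous_fderiv (by simp)).clm_apply continuous_const
  have hc' : HasCompactSupport fun x => fderiv ℝ φ x (EuclideanSpace.single k 1) :=
    hc.fderiv_apply ℝ _
  rw [setIntegral_eq_integral_of_forall_compl_eq_zero,
    setIntegral_eq_integral_of_forall_compl_eq_zero]
  · refine integral_mul_fderiv_eq_neg_fderiv_mul_of_integrable ?_ ?_ ?_
      (fun x _ => (hg.differentiable one_ne_zero).differentiableAt)
      (fun x _ => (hφ.differentiable (by simp)).differentiableAt)
    · exact (hg'.mul hφ.continuous).integrable_of_hasCompactSupport hc.mul_left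
    · exact (hg.continuous.mul hφ').integrable_of_hasCompactSupport hc'.mul_left
    · exact (hg.continuous.mul hφ.continuous).integrable_of_hasCompactSupport hc.mul_left
  · intro x hx
    rw [image_eq_zero_of_notMem_tsupport fun h => hx (hΩ h), mul_zero]
  · intro x hx
    have : fderiv ℝ φ x = 0 := image_eq_zero_of_notMem_tsupport
      fun h => hx (hΩ (tsupport_fderiv_subset ℝ h))
    rw [this, zero_apply, mul_zero]

theorem h1Norm_le_of_contDiff (hg : ContDiff ℝ 1 g) :
    h1Norm Ω g ≤ ((∫⁻ x in Ω, ‖g x‖ₑ ^ 2) +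
      ∑ k, ∫⁻ x in Ω, ‖fderiv ℝ g x (EuclideanSpace.single k 1)‖ₑ ^ 2) ^ (1 / 2 : ℝ) :=
  iInf₂_le (fun k x => fderiv ℝ g x (EuclideanSpace.single k 1))
    fun k => hg.hasWeakPartialDeriv Ω k

end WeakDerivative

/-! ### Values and derivatives of `𝓕⁻ H` as integrals of cosines and sines. -/

section Derivative

variable {d : ℕ} {H : Rd d → ℂ}

theorem contDiff_fourierInv (hH : Integrable H) (hH1 : Integrable fun ν => ‖ν‖ * ‖H ν‖) :
    ContDiff ℝ 1 (𝓕⁻ H) := by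
  rw [Real.fourierInv_eq_fourier_comp_neg]
  refine Real.contDiff_fourier (N := 1) fun n hn => ?_
  have hn' : n ≤ 1 := by exact_mod_cast hn
  interval_cases n
  · simpa using hH.comp_neg.norm
  · simpa using hH1.comp_neg

theorem fderiv_fourierInv_apply (hH : Integrable H) (hH1 : Integrable fun ν => ‖ν‖ * ‖H ν‖)
    (x v : Rd d) :
    fderiv ℝ (𝓕⁻ H) x v = (𝓕⁻ fun ν => (2 * Real.pi * inner ℝ ν v * Complex.I) * H ν) x := by
  have hH1' : Integrable fun ν => ‖ν‖ * ‖H (-ν)‖ := by simpa using hH1.comp_neg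
  have hi : Integrable (VectorFourier.fourierSMulRight (innerSL ℝ) fun ν => H (-ν)) := by
    refine (hH1'.const_mul (2 * Real.pi * ‖innerSL ℝ (E := Rd d)‖)).mono'
      hH.comp_neg.1.fourierSMulRight (.of_forall fun ν => ?_)
    rw [← mul_assoc]
    exact VectorFourier.norm_fourierSMulRight_le _ _ _
  rw [Real.fourierInv_eq_fourier_comp_neg, Real.fderiv_fourier hH.comp_neg hH1',
    Real.fourier_continuousLinearMap_apply hi, Real.fourierInv_eq_fourier_comp_neg]
  refine Real.fourier_congr_ae (.of_forall fun ν => ?_) x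
  simp only [VectorFourier.fourierSMulRight_apply, inner_neg_left, smul_eq_mul,
    innerSL_apply_apply ℝ, Complex.real_smul]
  push_cast
  ring

/-- The polar form of `z`: its argument becomes the phase of the cosine, hence the bias of a neuron.
-/
theorem fourierChar_mul_eq (r : ℝ) (z : ℂ) :
    (Real.fourierChar r : ℂ) * z = ‖z‖ * Complex.exp (((2 * Real.pi * r + z.arg : ℝ) : ℂ) *
      Complex.I) := by
  conv_lhs => rw [← Complex.norm_mul_exp_arg_mul_I z]
  rw [Real.fourierChar_apply, mul_left_comm, ← Complex.exp_add]
  push_cast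
  ring_nf

theorem re_fourierChar_mul (r : ℝ) (z : ℂ) :
    ((Real.fourierChar r : ℂ) * z).re = ‖z‖ * Real.cos (2 * Real.pi * r + z.arg) := by
  rw [fourierChar_mul_eq, Complex.re_ofReal_mul, Complex.exp_ofReal_mul_I_re]

theorem re_fourierChar_mul_I_mul (r a : ℝ) (z : ℂ) :
    ((Real.fourierChar r : ℂ) * ((a * Complex.I) * z)).re =
      -(a * ‖z‖ * Real.sin (2 * Real.pi * r + z.arg)) := by
  rw [mul_left_comm, fourierChar_mul_eq, mul_assoc, Complex.re_ofReal_mul, mul_left_comm,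
    Complex.re_ofReal_mul, Complex.I_mul_re, Complex.exp_ofReal_mul_I_im]
  ring

theorem re_fourierInv (hH : Integrable H) (x : Rd d) :
    ((𝓕⁻ H) x).re = ∫ ν, ‖H ν‖ * Real.cos (2 * Real.pi * inner ℝ ν x + (H ν).arg) := by
  rw [fourierInv_eq_integral_mul]
  refine (Complex.reCLM.integral_comp_comm (integrable_fourierChar_mul hH x)).symm.trans ?_
  exact integral_congr_ae (.of_forall fun ν => re_fourierChar_mul _ _)

theorem fderiv_re_fourierInv (hH : Integrable H) (hH1 : Integrable fun ν => ‖ν‖ * ‖H ν‖)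
    (x v : Rd d) :
    fderiv ℝ (fun x => ((𝓕⁻ H) x).re) x v = ∫ ν, -(2 * Real.pi * inner ℝ ν v * ‖H ν‖ *
      Real.sin (2 * Real.pi * inner ℝ ν x + (H ν).arg)) := by
  have h1 : HasFDerivAt (fun x => ((𝓕⁻ H) x).re) (Complex.reCLM ∘L fderiv ℝ (𝓕⁻ H) x) x :=
    Complex.reCLM.hasFDerivAt.comp x
      ((contDiff_fourierInv hH hH1).differentiable one_ne_zero).differentiableAt.hasFDerivAt
  have hi : Integrable fun ν => (2 * Real.pi * inner ℝ ν v * Complex.I) * H ν := by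
    refine (hH1.const_mul (2 * Real.pi * ‖v‖)).mono' ?_ (.of_forall fun ν => ?_)
    · exact (Continuous.aestronglyMeasurable (by fun_prop)).mul hH.1
    · have := norm_inner_le_norm (𝕜 := ℝ) ν v
      rw [norm_mul, norm_mul, norm_mul, norm_mul, Complex.norm_I, Complex.norm_real,
        Complex.norm_real, Complex.norm_ofNat, Real.norm_of_nonneg Real.pi_pos.le]
      calc 2 * Real.pi * ‖(inner ℝ ν v : ℝ)‖ * 1 * ‖H ν‖
          ≤ 2 * Real.pi * (‖ν‖ * ‖v‖) * 1 * ‖H ν‖ := by gcongr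
        _ = _ := by ring
  rw [h1.fderiv, ContinuousLinearMap.comp_apply, fderiv_fourierInv_apply hH hH1,
    fourierInv_eq_integral_mul]
  refine (Complex.reCLM.integral_comp_comm (integrable_fourierChar_mul hi x)).symm.trans ?_
  refine integral_congr_ae (.of_forall fun ν => ?_)
  have := re_fourierChar_mul_I_mul (inner ℝ ν x) (2 * Real.pi * inner ℝ ν v) (H ν)
  push_cast at this
  exact this

end Derivative

/-! ### Random cosine features and the H¹ error of their averages. -/

section CosineNetwork

variable {d : ℕ}

theorem contDiff_cosNetwork {n : ℕ} (a : Fin n → ℝ) (w : Fin n → Rd d) (b : Fin n → ℝ) :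
    ContDiff ℝ 1 (cosNetwork a w b) := by
  have h (j : Fin n) : ContDiff ℝ 1 fun x : Rd d => (inner ℝ (w j) x : ℝ) :=
    contDiff_const.inner ℝ contDiff_id
  unfold cosNetwork
  fun_prop

theorem fderiv_cosNetwork {n : ℕ} (a : Fin n → ℝ) (w : Fin n → Rd d) (b : Fin n → ℝ)
    (x v : Rd d) : fderiv ℝ (cosNetwork a w b) x v =
      (1 / (n : ℝ)) * ∑ j, -(a j * inner ℝ (w j) v * Real.sin (inner ℝ (w j) x + b j)) := by
  have h (j : Fin n) : HasFDerivAt (fun x => a j * Real.cos (inner ℝ (w j) x + b j))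
      (a j • (-Real.sin (inner ℝ (w j) x + b j) • innerSL ℝ (w j))) x :=
    (((innerSL ℝ (w j)).hasFDerivAt.add_const (b j)).cos).const_mul (a j)
  have h2 : HasFDerivAt (cosNetwork a w b) _ x :=
    (HasFDerivAt.fun_sum fun j (_ : j ∈ Finset.univ) => h j).const_mul (1 / (n : ℝ))
  rw [h2.fderiv]
  simp only [smul_apply, sum_apply, smul_eq_mul, innerSL_apply_apply ℝ]
  congr 1
  exact Finset.sum_congr rfl fun j _ => by ring

/-- The value (`none`) and the partial derivatives (`some k`) at `x` of the cosine ridge function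
of frequency `ν` in the sampling of `𝓕⁻ H`, where frequencies are drawn with a density
proportional to `w ‖H‖` of total mass `B`. -/
noncomputable def cosSample (t B : ℝ) (H : Rd d → ℂ) : Option (Fin d) → Rd d → Rd d → ℝ
  | none, ν, x => B / barronWeight t ν *
      Real.cos (2 * Real.pi * inner ℝ ν x + (H ν).arg)
  | some k, ν, x => -(B / barronWeight t ν * (2 * Real.pi * ν k) *
      Real.sin (2 * Real.pi * inner ℝ ν x + (H ν).arg))

variable {s B : ℝ} {H : Rd d → ℂ}

theorem measurable_cosSample (hH : Measurable H) (i : Option (Fin d)) :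
    Measurable (Function.uncurry (cosSample (s + 2) B H i)) := by
  have hw : Measurable fun q : Rd d × Rd d => B / barronWeight (s + 2) q.1 :=
    ((continuous_barronWeight (s + 2)).measurable.comp measurable_fst).const_div B
  have hθ : Measurable fun q : Rd d × Rd d => 2 * Real.pi * inner ℝ q.1 q.2 + (H q.1).arg :=
    Measurable.add (Continuous.measurable (by fun_prop))
      (Complex.measurable_arg.comp (hH.comp measurable_fst))
  cases i with
  | none => exact hw.mul (Real.measurable_cos.comp hθ)
  | some k =>
    have hk : Measurable fun q : Rd d × Rd d => 2 * Real.pi * q.1 k :=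
      Continuous.measurable (by fun_prop)
    exact ((hw.mul hk).mul (Real.measurable_sin.comp hθ)).neg

/-- With `q = 1 + |2πν|²` the sum is `(B/w)² (cos² + (q - 1) sin²) ≤ (B/w)² q`, where `w` is the
weight of order `s + 2`. Since `w ≥ q ≥ 1`, `q ≤ w²`; hence the constant one in the final bound. -/
theorem sum_cosSample_sq_le (hs : 0 ≤ s) (ν x : Rd d) :
    ∑ i, cosSample (s + 2) B H i ν x ^ 2 ≤ B ^ 2 := by
  set θ := 2 * Real.pi * inner ℝ ν x + (H ν).arg with hθ
  set q := 1 + (2 * Real.pi) ^ 2 * ‖ν‖ ^ 2 with hq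
  have hq1 : 1 ≤ q := by rw [hq]; nlinarith [sq_nonneg (2 * Real.pi * ‖ν‖)]
  have hw : q ≤ barronWeight (s + 2) ν := by
    rw [barronWeight_add_two]
    exact le_mul_of_one_le_right (by linarith) (one_le_barronWeight hs ν)
  have e : ∑ i, cosSample (s + 2) B H i ν x ^ 2 = (B / barronWeight (s + 2) ν) ^ 2 *
      (Real.cos θ ^ 2 + (q - 1) * Real.sin θ ^ 2) := by
    rw [Fintype.sum_option, hq, EuclideanSpace.real_norm_sq_eq, add_sub_cancel_left,
      Finset.mul_sum, Finset.sum_mul, mul_add, Finset.mul_sum]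
    congr 1
    · simp only [cosSample]
      ring
    · refine Finset.sum_congr rfl fun k _ => ?_
      simp only [cosSample]
      ring
  have h1 : Real.cos θ ^ 2 + (q - 1) * Real.sin θ ^ 2 ≤ q := by
    nlinarith [Real.sin_sq_add_cos_sq θ, sq_nonneg (Real.cos θ), sq_nonneg (Real.sin θ)]
  have hw0 := barronWeight_pos (s + 2) ν
  rw [e, div_pow, div_mul_eq_mul_div, div_le_iff₀ (by positivity)]
  refine mul_le_mul_of_nonneg_left (h1.trans ?_) (sq_nonneg B)
  nlinarith

theorem abs_cosSample_le (hs : 0 ≤ s) (hB : 0 ≤ B) (i : Option (Fin d)) (ν x : Rd d) :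
    |cosSample (s + 2) B H i ν x| ≤ B := by
  refine abs_le_of_sq_le_sq ?_ hB
  exact (Finset.single_le_sum (f := fun i => cosSample (s + 2) B H i ν x ^ 2)
    (fun i _ => sq_nonneg _) (Finset.mem_univ i)).trans (sum_cosSample_sq_le hs ν x)

/-- The sampling distribution of the frequencies. -/
noncomputable def sampleMeasure (t B : ℝ) (H : Rd d → ℂ) : Measure (Rd d) :=
  volume.withDensity fun ν => ENNReal.ofReal (‖(barronWeight t ν : ℂ) * H ν‖ / B)

theorem measurable_sampleDensity (t B : ℝ) (hH : Measurable H) :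
    Measurable fun ν => ENNReal.ofReal (‖(barronWeight t ν : ℂ) * H ν‖ / B) :=
  ENNReal.measurable_ofReal.comp ((((Complex.measurable_ofReal.comp
    (continuous_barronWeight t).measurable).mul hH).norm).div_const B)

theorem isProbabilityMeasure_sampleMeasure {t : ℝ}
    (hi : Integrable fun ν => (barronWeight t ν : ℂ) * H ν)
    (hB : B = ∫ ν, ‖(barronWeight t ν : ℂ) * H ν‖) (hB0 : 0 < B) :
    IsProbabilityMeasure (sampleMeasure t B H) := by
  refine ⟨?_⟩
  rw [sampleMeasure, withDensity_apply _ MeasurableSet.univ, setLIntegral_univ,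
    ← ofReal_integral_eq_lintegral_ofReal (hi.norm.div_const B)
      (.of_forall fun ν => by positivity), integral_div, ← hB, div_self hB0.ne',
    ENNReal.ofReal_one]

theorem integral_sampleMeasure {t : ℝ} (hH : Measurable H) (hB0 : 0 < B) (g : Rd d → ℝ) :
    ∫ ν, g ν ∂(sampleMeasure t B H) = ∫ ν, ‖H ν‖ * (barronWeight t ν / B) * g ν := by
  rw [sampleMeasure, integral_withDensity_eq_integral_toReal_smul
    (measurable_sampleDensity t B hH) (.of_forall fun ν => ENNReal.ofReal_lt_top)]
  refine integral_congr_ae (.of_forall fun ν => ?_)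
  have h0 := barronWeight_pos t ν
  simp only
  rw [ENNReal.toReal_ofReal (by positivity), norm_mul, Complex.norm_real,
    Real.norm_of_nonneg h0.le, smul_eq_mul]
  ring

/-- The density `w ‖H‖ / B` cancels the amplitude `B / w` and leaves the cosine representation of
the real part. -/
theorem integral_cosSample_none {t : ℝ} (hH : Measurable H) (hi : Integrable H) (hB0 : 0 < B)
    (x : Rd d) :
    ∫ ν, cosSample t B H none ν x ∂(sampleMeasure t B H) = ((𝓕⁻ H) x).re := by
  rw [integral_sampleMeasure hH hB0, re_fourierInv hi]
  refine integral_congr_ae (.of_forall fun ν => ?_)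
  have h0 := barronWeight_pos t ν
  simp only [cosSample]
  field_simp

theorem integral_cosSample_some {t : ℝ} (hH : Measurable H) (hi : Integrable H)
    (hi1 : Integrable fun ν => ‖ν‖ * ‖H ν‖) (hB0 : 0 < B) (x : Rd d) (k : Fin d) :
    ∫ ν, cosSample t B H (some k) ν x ∂(sampleMeasure t B H) =
      fderiv ℝ (fun x => ((𝓕⁻ H) x).re) x (EuclideanSpace.single k 1) := by
  rw [integral_sampleMeasure hH hB0, fderiv_re_fourierInv hi hi1]
  refine integral_congr_ae (.of_forall fun ν => ?_)
  have h0 := barronWeight_pos t ν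
  simp only [cosSample, EuclideanSpace.inner_single_right, one_mul, conj_trivial]
  field_simp

theorem integrable_norm_mul_norm (hs : 0 ≤ s)
    (hi : Integrable fun ν => (barronWeight (s + 2) ν : ℂ) * H ν) :
    Integrable fun ν => ‖ν‖ * ‖H ν‖ := by
  refine hi.norm.mono' ?_ (.of_forall fun ν => ?_)
  · exact continuous_norm.aestronglyMeasurable.mul
      (integrable_of_barronWeight_mul (by linarith) hi).1.norm
  · have h0 := barronWeight_pos (s + 2) ν
    rw [norm_mul, norm_norm, norm_norm, norm_mul, Complex.norm_real, Real.norm_of_nonneg h0.le]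
    refine mul_le_mul_of_nonneg_right ?_ (norm_nonneg _)
    have h1 := one_le_barronWeight hs ν
    have hpi := Real.pi_gt_three
    have h2 : ‖ν‖ ≤ 1 + (2 * Real.pi) ^ 2 * ‖ν‖ ^ 2 := by
      nlinarith [sq_nonneg (‖ν‖ - 1), mul_nonneg (sq_nonneg ‖ν‖)
        (show 0 ≤ (2 * Real.pi) ^ 2 - 1 by nlinarith)]
    rw [barronWeight_add_two]
    nlinarith [norm_nonneg ν]

theorem exists_cosNetwork_h1Norm_le_of_pos (hs : 0 ≤ s) (hH : Measurable H)
    (hi : Integrable fun ν => (barronWeight (s + 2) ν : ℂ) * H ν)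
    (hB : B = ∫ ν, ‖(barronWeight (s + 2) ν : ℂ) * H ν‖) (hB0 : 0 < B) {Ω : Set (Rd d)}
    (hΩ : volume Ω ≠ ⊤) {n : ℕ} (hn : 0 < n) :
    ∃ (a : Fin n → ℝ) (w : Fin n → Rd d) (b : Fin n → ℝ),
      h1Norm Ω (fun x => cosNetwork a w b x - ((𝓕⁻ H) x).re) ≤
        ENNReal.ofReal (B ^ 2 * (volume Ω).toReal / n) ^ (1 / 2 : ℝ) := by
  have hH1 := integrable_norm_mul_norm hs hi
  have hHi : Integrable H := integrable_of_barronWeight_mul (by linarith) hi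
  have hp := isProbabilityMeasure_sampleMeasure hi hB hB0
  have hfin : IsFiniteMeasure (volume.restrict Ω) := isFiniteMeasure_restrict.2 hΩ
  have hYm := fun i => measurable_cosSample (s := s) (B := B) hH i
  have hYD := abs_cosSample_le (H := H) hs hB0.le
  have hYi (i : Option (Fin d)) (ξ : Rd d) :
      Integrable (fun x => cosSample (s + 2) B H i ξ x ^ 2) (volume.restrict Ω) := by
    refine Integrable.of_bound
      (((hYm i).comp measurable_prodMk_left).pow_const 2).aestronglyMeasurable (B ^ 2)
      (.of_forall fun x => ?_)
    rw [norm_pow]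
    exact pow_le_pow_left₀ (norm_nonneg _) (hYD i ξ x) 2
  obtain ⟨ξ, hξ⟩ := exists_sample_sum_sq_le (p := sampleMeasure (s + 2) B H)
    (ρ := volume.restrict Ω) hYm hYD (b := B ^ 2 * (volume Ω).toReal) (fun ξ => by
      rw [← integral_finsetSum _ fun i _ => hYi i ξ]
      refine (integral_mono (integrable_finsetSum _ fun i _ => hYi i ξ) (integrable_const (B ^ 2))
        fun x => sum_cosSample_sq_le hs ξ x).trans (le_of_eq ?_)
      simp [Measure.real, mul_comm]) n
  let a : Fin n → ℝ := fun j => B / barronWeight (s + 2) (ξ j)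
  let w : Fin n → Rd d := fun j => (2 * Real.pi) • ξ j
  let b : Fin n → ℝ := fun j => (H (ξ j)).arg
  set e : Rd d → ℝ := fun x => cosNetwork a w b x - ((𝓕⁻ H) x).re with he
  have hre : ContDiff ℝ 1 fun x => ((𝓕⁻ H) x).re :=
    Complex.reCLM.contDiff.comp (contDiff_fourierInv hHi hH1)
  have hec : ContDiff ℝ 1 e := (contDiff_cosNetwork a w b).sub hre
  have hn0 : (n : ℝ) ≠ 0 := Nat.cast_ne_zero.2 hn.ne'
  let R : Option (Fin d) → Rd d → ℝ := fun i x =>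
    ∑ j, cosSample (s + 2) B H i (ξ j) x -
      n * ∫ ζ, cosSample (s + 2) B H i ζ x ∂(sampleMeasure (s + 2) B H)
  have h0 (x : Rd d) : e x = (n : ℝ)⁻¹ * R none x := by
    simp only [he, R]
    rw [integral_cosSample_none hH hHi hB0, mul_sub, inv_mul_cancel_left₀ hn0]
    simp only [cosNetwork, cosSample, a, w, b, inner_smul_left, one_div, conj_trivial]
  have hk (k : Fin d) (x : Rd d) :
      fderiv ℝ e x (EuclideanSpace.single k 1) = (n : ℝ)⁻¹ * R (some k) x := by
    have e1 : fderiv ℝ e x = fderiv ℝ (cosNetwork a w b) x -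
        fderiv ℝ (fun x => ((𝓕⁻ H) x).re) x :=
      fderiv_fun_sub ((contDiff_cosNetwork a w b).differentiable one_ne_zero).differentiableAt
        (hre.differentiable one_ne_zero).differentiableAt
    simp only [R]
    rw [e1, sub_apply, integral_cosSample_some hH hHi hH1 hB0, mul_sub,
      inv_mul_cancel_left₀ hn0, fderiv_cosNetwork]
    simp [cosSample, a, w, b, inner_smul_left, EuclideanSpace.inner_single_right]
  -- Continuity of the residuals is read off from the C¹ function `e`, of which they are `n` times
  -- the value and the partial derivatives.
  have hRc (i : Option (Fin d)) : Continuous (R i) := by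
    have h1 : R i = fun x => (n : ℝ) * ((n : ℝ)⁻¹ * R i x) := by
      ext x
      rw [mul_inv_cancel_left₀ hn0]
    rw [h1]
    cases i with
    | none =>
      simp only [← h0]
      exact continuous_const.mul hec.continuous
    | some k =>
      simp only [← hk]
      exact continuous_const.mul
        ((hec.continuous_fderiv one_ne_zero).clm_apply continuous_const)
  have hRi (i : Option (Fin d)) : Integrable (fun x => R i x ^ 2) (volume.restrict Ω) := by
    refine Integrable.of_bound ((hRc i).pow 2).aestronglyMeasurable ((n * B + n * B) ^ 2)
      (.of_forall fun x => ?_)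
    rw [norm_pow]
    refine pow_le_pow_left₀ (norm_nonneg _) ((norm_sub_le _ _).trans (add_le_add ?_ ?_)) 2
    · refine (norm_sum_le _ _).trans ((Finset.sum_le_sum fun j _ => hYD i (ξ j) x).trans ?_)
      simp
    · rw [norm_mul, Real.norm_natCast]
      refine mul_le_mul_of_nonneg_left ?_ (Nat.cast_nonneg n)
      have := norm_integral_le_of_norm_le_const (μ := sampleMeasure (s + 2) B H)
        (f := fun ζ => cosSample (s + 2) B H i ζ x) (C := B) (.of_forall fun ζ => hYD i ζ x)
      simpa using this
  have hlin (i : Option (Fin d)) : ∫⁻ x in Ω, ‖(n : ℝ)⁻¹ * R i x‖ₑ ^ 2 =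
      ENNReal.ofReal (((n : ℝ) ^ 2)⁻¹ * ∫ x in Ω, R i x ^ 2) := by
    rw [← integral_const_mul, ofReal_integral_eq_lintegral_ofReal ((hRi i).const_mul _)
      (.of_forall fun x => by positivity)]
    refine lintegral_congr fun x => ?_
    rw [← ofReal_norm, ← ENNReal.ofReal_pow (norm_nonneg _), Real.norm_eq_abs, sq_abs, mul_pow,
      inv_pow]
  refine ⟨a, w, b, (h1Norm_le_of_contDiff hec).trans ?_⟩
  refine ENNReal.rpow_le_rpow ?_ (by norm_num)
  simp only [h0, hk, hlin]
  have hnn (i : Option (Fin d)) : 0 ≤ ((n : ℝ) ^ 2)⁻¹ * ∫ x in Ω, R i x ^ 2 :=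
    mul_nonneg (by positivity) (integral_nonneg fun x => sq_nonneg _)
  rw [← ENNReal.ofReal_sum_of_nonneg fun k _ => hnn (some k), ← ENNReal.ofReal_add (hnn none)
    (Finset.sum_nonneg fun k _ => hnn (some k)),
    ← Fintype.sum_option (fun i => ((n : ℝ) ^ 2)⁻¹ * ∫ x in Ω, R i x ^ 2), ← Finset.mul_sum]
  refine ENNReal.ofReal_le_ofReal ?_
  refine (mul_le_mul_of_nonneg_left hξ (by positivity)).trans (le_of_eq ?_)
  field_simp

variable {u : Rd d → ℝ}

theorem exists_cosNetwork_h1Norm_le (hs : 0 ≤ s) (hu : u ∈ BarronSpace d (s + 2))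
    {Ω : Set (Rd d)} (hΩ : volume Ω ≠ ⊤) {n : ℕ} (hn : 0 < n) :
    ∃ (a : Fin n → ℝ) (w : Fin n → Rd d) (b : Fin n → ℝ),
      h1Norm Ω (fun x => cosNetwork a w b x - u x) ≤
        barronNorm (s + 2) u * (volume Ω) ^ (1 / 2 : ℝ) / (n : ℝ≥0∞) ^ (1 / 2 : ℝ) := by
  obtain ⟨H₀, hH₀⟩ := exists_isBarronSpectrum (by linarith) hu
  -- A Borel representative of the spectrum is chosen, since amplitudes and phases must be jointly
  -- measurable in frequency and position.
  obtain ⟨H, hHm, hH⟩ : ∃ H : Rd d → ℂ, Measurable H ∧ IsBarronSpectrum (s + 2) u H := by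
    have hm := (hH₀.integrable (by linarith)).1
    refine ⟨hm.mk, hm.stronglyMeasurable_mk.measurable, hH₀.1.congr ?_, ?_⟩
    · filter_upwards [hm.ae_eq_mk] with ν hν
      rw [← hν]
    · rw [← funext fun x => Real.fourierInv_congr_ae hm.ae_eq_mk x]
      exact hH₀.2
  have hae (a : Fin n → ℝ) (w : Fin n → Rd d) (b : Fin n → ℝ) :
      h1Norm Ω (fun x => cosNetwork a w b x - u x) =
        h1Norm Ω fun x => cosNetwork a w b x - ((𝓕⁻ H) x).re := by
    refine h1Norm_congr_ae ?_
    filter_upwards [hH.ae_eq_re] with x hx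
    rw [hx]
  simp only [hae]
  set B := ∫ ν, ‖(barronWeight (s + 2) ν : ℂ) * H ν‖ with hB
  have hBn : barronNorm (s + 2) u = ENNReal.ofReal B := by
    rw [hH.barronNorm_eq (by linarith), hB, ofReal_integral_norm_eq_lintegral_enorm hH.1]
  have hB0 : 0 ≤ B := integral_nonneg fun ν => norm_nonneg _
  rcases hB0.eq_or_lt with hz | hpos
  -- For `B = 0` there is no density to normalize, but then the spectrum vanishes and the zero
  -- network is exact.
  · have hH0 : H =ᵐ[volume] 0 := by
      have h1 := (integral_eq_zero_iff_of_nonneg (fun ν => norm_nonneg _) hH.1.norm).1 hz.symm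
      filter_upwards [h1] with ν hν
      have h2 : (barronWeight (s + 2) ν : ℂ) * H ν = 0 := norm_eq_zero.1 hν
      exact (mul_eq_zero.1 h2).resolve_left (barronWeight_ne_zero _ ν)
    have h0 : (fun x => cosNetwork (0 : Fin n → ℝ) (0 : Fin n → Rd d) 0 x - ((𝓕⁻ H) x).re) =
        fun _ => 0 := by
      ext x
      rw [Real.fourierInv_congr_ae hH0, fourierInv_eq_integral_mul]
      simp [cosNetwork]
    refine ⟨0, 0, 0, ?_⟩
    rw [h0]
    refine (h1Norm_le_of_contDiff contDiff_const).trans ?_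
    simp
  · obtain ⟨a, w, b, h⟩ := exists_cosNetwork_h1Norm_le_of_pos hs hHm hH.1 hB hpos hΩ hn
    refine ⟨a, w, b, h.trans (le_of_eq ?_)⟩
    rw [ENNReal.ofReal_div_of_pos (by positivity), ENNReal.ofReal_mul (by positivity),
      ENNReal.ofReal_toReal hΩ, ENNReal.ofReal_natCast, ENNReal.div_rpow_of_nonneg _ _ (by norm_num),
      ENNReal.mul_rpow_of_nonneg _ _ (by norm_num), ENNReal.ofReal_pow hB0, hBn,
      ← ENNReal.rpow_natCast, ← ENNReal.rpow_mul]
    norm_num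

end CosineNetwork

theorem theorem2p2 (d : ℕ) (hd : 0 < d) (s : ℝ) (hs : 0 ≤ s) (V W : Rd d → ℝ) (α : ℝ)
    (hα : 0 < α) (hV : ∀ x, 0 ≤ V x) (hVW : ∀ x, V x = α + W x) (hW : W ∈ BarronSpace d s) :
    -- existence and uniqueness of the solution `u*`
    (∀ f ∈ BarronSpace d s, ∃ u ∈ BarronSpace d (s + 2), SolvesSchrodinger V f u ∧
      ∀ v ∈ BarronSpace d (s + 2), SolvesSchrodinger V f v → v =ᵐ[volume] u) ∧
    -- a constant of the regularity estimate exists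
    (∃ C : ℝ≥0, RegularityEstimate V s C) ∧
    -- approximation of the solution with any such constant
    (∀ C : ℝ≥0, RegularityEstimate V s C →
      ∀ f ∈ BarronSpace d s, ∀ u ∈ BarronSpace d (s + 2), SolvesSchrodinger V f u →
        ∀ Ω : Set (Rd d), IsOpen Ω → Bornology.IsBounded Ω → ∀ n : ℕ, 0 < n →
          ∃ (a : Fin n → ℝ) (w : Fin n → Rd d) (b : Fin n → ℝ),
            h1Norm Ω (fun x => cosNetwork a w b x - u x) ≤
              (C : ℝ≥0∞) * (volume Ω) ^ (1 / 2 : ℝ) * barronNorm s f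
                / (n : ℝ≥0∞) ^ (1 / 2 : ℝ)) := by
  refine ⟨fun f hf => exists_unique_solution hd hα hs hV hVW hW hf,
    exists_regularityEstimate hd hα hs hV hVW hW,
    fun C hC f hf u hu hsol Ω _ hΩ n hn => ?_⟩
  obtain ⟨a, w, b, h⟩ := exists_cosNetwork_h1Norm_le hs hu hΩ.measure_lt_top.ne hn
  refine ⟨a, w, b, h.trans ?_⟩
  rw [mul_right_comm]
  gcongr
  exact hC f hf u hu hsol
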